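/- **Setup.** Let $\iota: H\hookrightarrow G$ be a closed embedding of unimodular locally profinite groups; we identify $H$ with its image. Let $\Upsilon_H,\Upsilon_G$ be non-empty collections of compact open subgroups of $H$ and $G$, each stable under conjugation and under pairwise intersection, and such that for all members $K,L$ there is a member $K'\subseteq L$ that is normal in $K$. Assume $K\cap H\in\Upsilon_H$ for all $K\in\Upsilon_G$. Let $\mathcal O$ be an integral domain of characteristic $0$ and $\Phi$ a field containing $\mathcal O$. An RIC functor $M$ on $(G,\Upsilon_G)$ consists of $\mathcal O$-modules $M(K)$, $K\in\Upsilon_G$, and, for all $g\in G$ and $L,K\in\Upsilon_G$ with $g^{-1}Lg\subseteq K$, linear maps $[g]^*:M(K)\to M(L)$ and $[g]_*:M(L)\to M(K)$, functorial for the composition $(L\xrightarrow{g}K)\circ(L'\xrightarrow{h}L)=(L'\xrightarrow{hg}K)$, with $[g]^*=[g^{-1}]_*$ if $g^{-1}Lg=K$ and $[\gamma]_*=\mathrm{id}$ on $M(K)$ for $\gamma\in K$. For $L\subseteq K$ write $\mathrm{pr}_{L,K}^*=[1]^*$ and $\mathrm{pr}_{L,K,*}=[1]_*$. $M$ is CoMack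 if $\mathrm{pr}_{L,K,*}\circ\mathrm{pr}_{L,K}^*=[K:L]$ for $L\subseteq K$, and if for $L,L'\subseteq K$ one has $\mathrm{pr}_{L,K}^*\circ\mathrm{pr}_{L',K,*}=\sum_{\gamma\in L\backslash K/L'}\mathrm{pr}_{L_\gamma,L,*}\circ[\gamma]^*$ with $L_\gamma=L\cap\gamma L'\gamma^{-1}$. RIC functors on $(H,\Upsilon_H)$ are defined likewise. Let $M_H,M_G$ be CoMack functors on $(H,\Upsilon_H)$, $(G,\Upsilon_G)$ valued in $\mathcal O$-modules, and $\iota_*:M_H\to M_G$ a pushforward: linear maps $\iota_{U,K,*}:M_H(U)\to M_G(K)$ for all $U\in\Upsilon_H$, $K\in\Upsilon_G$ with $U\subseteq K$, such that $\iota_{U,K,*}\circ[h]_*=[h]_*\circ\iota_{V,L,*}$ whenever $h\in H$, $V\subseteq L$, $h^{-1}Vh\subseteq U$ and $h^{-1}Lh\subseteq K$. For $V\in\Upsilon_H$, $g\in G$, $K\in\Upsilon_G$ let $[VgK]_*:M_H(V)\to M_G(K)$ be the composite $$M_H(V)\xrightarrow{\mathrm{pr}^*}M_H(V\cap gKg^{-1})\xrightarrow{\iota_*}M_G(gKg^{-1})\xrightarrow{[g]_*}M_G(K).$$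 Let $\widehat M$ be the inductive limit of $M_H(V)\otimes_{\mathcal O}\Phi$ over $V\in\Upsilon_H$ along restrictions, with its action of $H$ induced by the maps $[h]^*:M_H(V)\to M_H(hVh^{-1})$, and let $j_V:M_H(V)\to\widehat M$ be the natural map. Put $[V:W]=\mu(V)/\mu(W)\in\mathbb Q$ for a Haar measure $\mu$ on $H$. Fix $L,K\in\Upsilon_G$ with $L$ a normal subgroup of $K$, put $U=K\cap H$, and fix $x_U\in M_H(U)$ and a non-zero compactly supported $K$-bi-invariant function $\mathfrak H:G\to\mathcal O$. Let $\mathcal C(G/K,\widehat M)$ be the space of compactly supported right $K$-invariant functions $\xi:G\to\widehat M$, with $H$ acting by $(h\xi)(g)=h\,\xi(h^{-1}g)$. A *zeta element* for $(x_U,\mathfrak H,L)$ is a $\zeta\in\mathcal C(G/K,\widehat M)$ that has the same image in the $H$-coinvariants of $\mathcal C(G/K,\widehat M)$ as $j_U(x_U)\otimes\mathfrak H: g\mapsto\mathfrak H(g)\,j_U(x_U)$, and such that each value $\zeta(g)$ is a finite sum of terms $[U:V]\,j_V(x)$ with $V\in\Upsilon_H$, $V\subseteq gLg^{-1}$ and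 $x\in M_H(V)$. A class $y_L\in M_G(L)$ is *associated* with $\zeta$ if there are finitely many $g_i\in G$, $V_i\in\Upsilon_H$ with $V_i\subseteq g_iLg_i^{-1}$, and $x_i\in M_H(V_i)$ with $\zeta=\sum_i[U:V_i]\,j_{V_i}(x_i)\otimes\mathrm{ch}(g_iK)$ and $y_L=\sum_i[V_ig_iL]_*(x_i)$. Let $A=H\backslash(H\cdot\mathrm{supp}\,\mathfrak H)/K$ (a finite set). For each $\alpha\in A$ choose a representative $g_\alpha\in G$ and put $H_\alpha=H\cap g_\alpha Kg_\alpha^{-1}$, $V_\alpha=H\cap g_\alpha Lg_\alpha^{-1}$, and $\mathfrak h_\alpha(h)=\mathfrak H(hg_\alpha)$, $\mathfrak h_\alpha^t(h)=\mathfrak h_\alpha(h^{-1})$ for $h\in H$. Put $\mathfrak h_\alpha^t\cdot j_U(x_U)=\sum_{h\in H/U}\mathfrak h_\alpha^t(h)\,h\,j_U(x_U)$ (the Hecke action for the Haar measure with $\mu(U)=1$), and $$\mathfrak h_{\alpha,*}=\sum_{h\in U\backslash H/H_\alpha}\mathfrak h_\alpha(h)\,[H_\alpha h^{-1}U]:M_H(U)\to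 M_H(H_\alpha),$$ where $[H_\alpha h^{-1}U]$ is the composite $M_H(U)\xrightarrow{\mathrm{pr}^*}M_H(U\cap hH_\alpha h^{-1})\xrightarrow{[h^{-1}]^*}M_H(h^{-1}Uh\cap H_\alpha)\xrightarrow{\mathrm{pr}_*}M_H(H_\alpha)$. **Theorem.** 1. A zeta element for $(x_U,\mathfrak H,L)$ exists if and only if there are classes $x_{V_\alpha}\in M_H(V_\alpha)$, $\alpha\in A$, such that for every $\alpha\in A$ $$\mathfrak h_\alpha^t\cdot j_U(x_U)=j_{H_\alpha}\big(\mathrm{pr}_{V_\alpha,H_\alpha,*}(x_{V_\alpha})\big)\quad\text{in }\widehat M.\tag{$*$}$$ 2. For $\alpha\in A$ and $x_{V_\alpha}\in M_H(V_\alpha)$, equation $(*)$ holds if and only if $\mathfrak h_{\alpha,*}(x_U)-\mathrm{pr}_{V_\alpha,H_\alpha,*}(x_{V_\alpha})$ is an $\mathcal O$-torsion element of $M_H(H_\alpha)$. 3. If all the modules $M_H(V)$, $V\in\Upsilon_H$, are $\mathcal O$-torsion free, then for every zeta element $\zeta$ and every class $y_L$ associated with $\zeta$ the classes $x_{V_\alpha}$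 satisfying $(*)$ can be chosen so that moreover $$\mathrm{pr}_{L,K,*}(y_L)=\sum_{\alpha\in A}[V_\alpha g_\alpha K]_*(x_{V_\alpha}).$$ -/

import Mathlib

open scoped TensorProduct

universe u v w w' t z

/-! ### Groups, indices, levels -/

/-- A locally compact group is unimodular if its modular character is trivial, i.e. its left Haar
measures are right invariant. -/
def IsUnimodular (G : Type u) [Group G] [TopologicalSpace G] [IsTopologicalGroup G]
    [LocallyCompactSpace G] : Prop :=
  (MeasureTheory.Measure.modularCharacter : G →* NNReal) = 1

/-- The conjugate subgroup `g K g⁻¹`. -/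
def conjSub {G : Type u} [Group G] (g : G) (K : Subgroup G) : Subgroup G :=
  K.map (MulAut.conj g).toMonoidHom

theorem mem_conjSub {G : Type u} [Group G] {g x : G} {K : Subgroup G} :
    x ∈ conjSub g K ↔ g⁻¹ * x * g ∈ K := by
  unfold conjSub
  rw [Subgroup.mem_map]
  constructor
  · rintro ⟨y, hy, rfl⟩
    simpa [mul_assoc] using hy
  · intro h
    exact ⟨_, h, by simp [mul_assoc]⟩

/-- `Moves g L K` says that `g⁻¹ L g ⊆ K`, i.e. that `g` defines a morphism `L ⟶ K` in the
category of compact opens. -/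
def Moves {G : Type u} [Group G] (g : G) (L K : Subgroup G) : Prop :=
  ∀ x ∈ L, g⁻¹ * x * g ∈ K

theorem Moves.of_le {G : Type u} [Group G] {L K : Subgroup G} (h : L ≤ K) : Moves 1 L K := by
  intro x hx
  simpa using h hx

theorem Moves.mul {G : Type u} [Group G] {g h : G} {L' L K : Subgroup G} (hg : Moves g L K)
    (hh : Moves h L' L) : Moves (h * g) L' K := by
  intro x hx
  have := hg _ (hh x hx)
  simpa [mul_assoc] using this

/-- The generalized index `[V : W] = [V : V ∩ W] / [W : V ∩ W]` of commensurable subgroups.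
For compact open subgroups it is the ratio `μ V / μ W` for every left Haar measure `μ`, see
`genIndex_eq_haar`. -/
noncomputable def genIndex {G : Type u} [Group G] (V W : Subgroup G) : ℚ :=
  (W.relIndex V : ℚ) / (V.relIndex W : ℚ)

theorem haar_relIndex {G : Type u} [Group G] [TopologicalSpace G] [IsTopologicalGroup G]
    [MeasurableSpace G] [BorelSpace G] (μ : MeasureTheory.Measure G)
    [MeasureTheory.Measure.IsHaarMeasure μ] {V W : Subgroup G} (hV : IsCompact (V : Set G))
    (hW : IsOpen (W : Set G)) (hVo : IsOpen (V : Set G)) :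
    W.relIndex V ≠ 0 ∧ μ (V : Set G) = (W.relIndex V : ENNReal) * μ ((V ⊓ W : Subgroup G) : Set G) := by
  have : CompactSpace V := isCompact_iff_compactSpace.1 hV
  have hopen : IsOpen ((W.subgroupOf V : Subgroup V) : Set V) :=
    hW.preimage continuous_subtype_val
  have : Finite (V ⧸ W.subgroupOf V) := Subgroup.quotient_finite_of_isOpen _ hopen
  have := Fintype.ofFinite (V ⧸ W.subgroupOf V)
  have hfi : (W.subgroupOf V).FiniteIndex := Subgroup.finiteIndex_of_finite_quotient
  refine ⟨hfi.index_ne_zero, ?_⟩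
  have hdecomp : (V : Set G) =
      ⋃ c : V ⧸ W.subgroupOf V, (fun x => (c.out : G)⁻¹ * x) ⁻¹' ((V ⊓ W : Subgroup G) : Set G) := by
    ext x
    simp only [SetLike.mem_coe, Set.mem_iUnion, Set.mem_preimage, Subgroup.mem_inf]
    constructor
    · intro hx
      refine ⟨QuotientGroup.mk ⟨x, hx⟩, V.mul_mem (V.inv_mem (Subtype.mem _)) hx, ?_⟩
      have := QuotientGroup.eq.1 (QuotientGroup.out_eq' (QuotientGroup.mk (s := W.subgroupOf V) ⟨x, hx⟩))
      simpa [Subgroup.mem_subgroupOf] using this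
    · rintro ⟨c, hc, -⟩
      simpa using V.mul_mem c.out.2 hc
  have hmeas : MeasurableSet ((V ⊓ W : Subgroup G) : Set G) :=
    (hVo.inter hW).measurableSet
  have hdisj : Pairwise (Function.onFun Disjoint fun c : V ⧸ W.subgroupOf V =>
      (fun x => (c.out : G)⁻¹ * x) ⁻¹' ((V ⊓ W : Subgroup G) : Set G)) := by
    intro c d hcd
    rw [Function.onFun, Set.disjoint_left]
    intro x hx hx'
    apply hcd
    rw [← QuotientGroup.out_eq' c, ← QuotientGroup.out_eq' d, QuotientGroup.eq,
      Subgroup.mem_subgroupOf]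
    have := W.mul_mem hx.2 (W.inv_mem hx'.2)
    simpa [mul_assoc] using this
  conv_lhs => rw [hdecomp]
  rw [MeasureTheory.measure_iUnion hdisj
    (fun c => (measurable_const_mul (c.out : G)⁻¹) hmeas)]
  simp only [MeasureTheory.measure_preimage_mul, tsum_fintype, Finset.sum_const, nsmul_eq_mul]
  congr 2
  rw [Finset.card_univ, ← Nat.card_eq_fintype_card]
  rfl

theorem genIndex_eq_haar {G : Type u} [Group G] [TopologicalSpace G] [IsTopologicalGroup G]
    [MeasurableSpace G] [BorelSpace G] (μ : MeasureTheory.Measure G)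
    [MeasureTheory.Measure.IsHaarMeasure μ] {V W : Subgroup G} (hV : IsCompact (V : Set G))
    (hVo : IsOpen (V : Set G)) (hW : IsCompact (W : Set G)) (hWo : IsOpen (W : Set G)) :
    (genIndex V W : ℝ) = μ.real (V : Set G) / μ.real (W : Set G) := by
  obtain ⟨h1, e1⟩ := haar_relIndex μ hV hWo hVo
  obtain ⟨h2, e2⟩ := haar_relIndex μ hW hVo hWo
  rw [inf_comm] at e2
  have hpos : 0 < μ ((V ⊓ W : Subgroup G) : Set G) :=
    (hVo.inter hWo).measure_pos μ ⟨1, V.one_mem, W.one_mem⟩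
  have hfin : μ ((V ⊓ W : Subgroup G) : Set G) < ⊤ :=
    lt_of_le_of_lt (MeasureTheory.measure_mono (fun x hx => hx.1)) hV.measure_lt_top
  have hne : (μ ((V ⊓ W : Subgroup G) : Set G)).toReal ≠ 0 :=
    (ENNReal.toReal_pos hpos.ne' hfin.ne).ne'
  unfold genIndex MeasureTheory.Measure.real
  rw [e1, e2, ENNReal.toReal_mul, ENNReal.toReal_mul, mul_div_mul_right _ _ hne]
  simp

/-- A non-empty collection of compact open subgroups stable under conjugation and intersection,
and such that any member `K` has, inside any member `L`, a normal subgroup that is a member. -/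
structure LevelSystem (G : Type u) [Group G] [TopologicalSpace G] where
  carrier : Set (Subgroup G)
  nonempty : carrier.Nonempty
  isCompact : ∀ K ∈ carrier, IsCompact (K : Set G)
  isOpen : ∀ K ∈ carrier, IsOpen (K : Set G)
  conj_mem : ∀ g : G, ∀ K ∈ carrier, conjSub g K ∈ carrier
  exists_normal : ∀ K ∈ carrier, ∀ L ∈ carrier,
    ∃ K' ∈ carrier, K' ≤ K ∧ (K'.subgroupOf K).Normal ∧ K' ≤ L
  inf_mem : ∀ K ∈ carrier, ∀ L ∈ carrier, K ⊓ L ∈ carrier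

/-- The members of a collection of compact open subgroups, ordered by inclusion. -/
abbrev LevelSystem.Level {G : Type u} [Group G] [TopologicalSpace G] (Υ : LevelSystem G) : Type u :=
  {K : Subgroup G // K ∈ Υ.carrier}

/-- The level `g K g⁻¹`. -/
def conjLevel {G : Type u} [Group G] [TopologicalSpace G] {Υ : LevelSystem G} (g : G)
    (K : Υ.Level) : Υ.Level :=
  ⟨conjSub g K.1, Υ.conj_mem g K.1 K.2⟩

/-- The level `K ∩ L`. -/
def infLevel {G : Type u} [Group G] [TopologicalSpace G] {Υ : LevelSystem G}
    (K L : Υ.Level) : Υ.Level :=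
  ⟨K.1 ⊓ L.1, Υ.inf_mem K.1 K.2 L.1 L.2⟩

theorem infLevel_le_left {G : Type u} [Group G] [TopologicalSpace G] {Υ : LevelSystem G}
    (K L : Υ.Level) : infLevel K L ≤ K :=
  fun _ hx => hx.1

theorem infLevel_le_right {G : Type u} [Group G] [TopologicalSpace G] {Υ : LevelSystem G}
    (K L : Υ.Level) : infLevel K L ≤ L :=
  fun _ hx => hx.2

theorem moves_conjLevel {G : Type u} [Group G] [TopologicalSpace G] {Υ : LevelSystem G} (g : G)
    (K : Υ.Level) : Moves g (conjLevel g K).1 K.1 :=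
  fun _ hx => mem_conjSub.1 hx

/-! ### RIC functors -/

/-- An RIC functor on `(G, Υ)` valued in `R`-modules: modules `M(K)`, and for every morphism
`g : L ⟶ K` (i.e. `g⁻¹ L g ⊆ K`) a pullback `[g]^* : M(K) → M(L)` and a pushforward
`[g]_* : M(L) → M(K)`. The composite of `h : L' ⟶ L` and `g : L ⟶ K` is `h * g : L' ⟶ K`. -/
structure RICFunctor (R : Type z) [CommRing R] {G : Type u} [Group G] [TopologicalSpace G]
    (Υ : LevelSystem G) where
  obj : Υ.Level → Type w
  [addCommGroup : ∀ K, AddCommGroup (obj K)]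
  [module : ∀ K, Module R (obj K)]
  pull : ∀ {L K : Υ.Level} (g : G), Moves g L.1 K.1 → (obj K →ₗ[R] obj L)
  push : ∀ {L K : Υ.Level} (g : G), Moves g L.1 K.1 → (obj L →ₗ[R] obj K)
  pull_one : ∀ (K : Υ.Level) (h : Moves 1 K.1 K.1), pull 1 h = LinearMap.id
  push_one : ∀ (K : Υ.Level) (h : Moves 1 K.1 K.1), push 1 h = LinearMap.id
  pull_mul : ∀ {L' L K : Υ.Level} (g h : G) (hg : Moves g L.1 K.1) (hh : Moves h L'.1 L.1),
    pull (h * g) (hg.mul hh) = pull h hh ∘ₗ pull g hg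
  push_mul : ∀ {L' L K : Υ.Level} (g h : G) (hg : Moves g L.1 K.1) (hh : Moves h L'.1 L.1),
    push (h * g) (hg.mul hh) = push g hg ∘ₗ push h hh
  pull_eq_push : ∀ {L K : Υ.Level} (g : G) (hg : Moves g L.1 K.1) (hg' : Moves g⁻¹ K.1 L.1),
    pull g hg = push g⁻¹ hg'
  push_of_mem : ∀ (K : Υ.Level) (γ : G), γ ∈ K.1 → ∀ h : Moves γ K.1 K.1,
    push γ h = LinearMap.id

attribute [instance] RICFunctor.addCommGroup RICFunctor.module

namespace RICFunctor

variable {R : Type z} [CommRing R] {G : Type u} [Group G] [TopologicalSpace G] {Υ : LevelSystem G}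

/-- The restriction `pr_{L,K}^* : M(K) → M(L)` for `L ⊆ K`. -/
def res (M : RICFunctor.{u, w} R Υ) {L K : Υ.Level} (h : L ≤ K) : M.obj K →ₗ[R] M.obj L :=
  M.pull 1 (Moves.of_le h)

/-- The induction `pr_{L,K,*} : M(L) → M(K)` for `L ⊆ K`. -/
def ind (M : RICFunctor.{u, w} R Υ) {L K : Υ.Level} (h : L ≤ K) : M.obj L →ₗ[R] M.obj K :=
  M.push 1 (Moves.of_le h)

/-- `M` is cohomological: `pr_* ∘ pr^*` is multiplication by the index. -/
def IsCohomological (M : RICFunctor.{u, w} R Υ) : Prop :=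
  ∀ (L K : Υ.Level) (h : L ≤ K) (x : M.obj K),
    M.ind h (M.res h x) = L.1.relIndex K.1 • x

theorem moves_mackey {L L' : Υ.Level} (γ : G) :
    Moves γ (infLevel L (conjLevel γ L')).1 L'.1 :=
  fun _ hx => mem_conjSub.1 hx.2

/-- `M` is Mackey: for `L, L' ⊆ K` and representatives `γ ∈ K` of `L \ K / L'`,
`pr_{L,K}^* ∘ pr_{L',K,*} = ∑_γ pr_{L_γ,L,*} ∘ [γ]^*_{L_γ,L'}` with `L_γ = L ∩ γ L' γ⁻¹`. -/
def IsMackey (M : RICFunctor.{u, w} R Υ) : Prop :=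
  ∀ (K L L' : Υ.Level) (hL : L ≤ K) (hL' : L' ≤ K) (s : Finset G),
    (∀ γ ∈ s, γ ∈ K.1) →
    (∀ k ∈ K.1, ∃! γ, γ ∈ s ∧ ∃ l ∈ L.1, ∃ l' ∈ L'.1, k = l * γ * l') →
    ∀ x : M.obj L', M.res hL (M.ind hL' x) =
      ∑ γ ∈ s, M.ind (infLevel_le_left L (conjLevel γ L'))
        (M.pull γ (moves_mackey γ) x)

/-- `M` is CoMack: both cohomological and Mackey. -/
def IsCoMack (M : RICFunctor.{u, w} R Υ) : Prop :=
  M.IsCohomological ∧ M.IsMackey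

/-- All the modules `M(K)` are `R`-torsion free. -/
def IsTorsionFree (M : RICFunctor.{u, w} R Υ) : Prop :=
  ∀ K : Υ.Level, Module.IsTorsionFree R (M.obj K)

/-- The functor `K ↦ S ⊗ M(K)` for an `R`-algebra `S`. -/
noncomputable def baseChange (M : RICFunctor.{u, w} R Υ) (S : Type w') [CommRing S] [Algebra R S] :
    RICFunctor.{u, max w w'} S Υ where
  obj K := S ⊗[R] M.obj K
  pull g h := (M.pull g h).baseChange S
  push g h := (M.push g h).baseChange S
  pull_one K h := by rw [M.pull_one, LinearMap.baseChange_id]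
  push_one K h := by rw [M.push_one, LinearMap.baseChange_id]
  pull_mul g h hg hh := by rw [M.pull_mul g h hg hh, LinearMap.baseChange_comp]
  push_mul g h hg hh := by rw [M.push_mul g h hg hh, LinearMap.baseChange_comp]
  pull_eq_push g hg hg' := by rw [M.pull_eq_push g hg hg']
  push_of_mem K γ hγ h := by rw [M.push_of_mem K γ hγ h, LinearMap.baseChange_id]

theorem pull_mul_apply (M : RICFunctor.{u, w} R Υ) {L' L K : Υ.Level} {g h k : G}
    (hg : Moves g L.1 K.1) (hh : Moves h L'.1 L.1) (hk : Moves k L'.1 K.1) (e : k = h * g)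
    (x : M.obj K) : M.pull h hh (M.pull g hg x) = M.pull k hk x := by
  subst e
  exact (LinearMap.congr_fun (M.pull_mul g h hg hh) x).symm

open Classical in
/-- The inductive completion: the direct limit of the `M(K)` over all levels `K`, ordered by
reverse inclusion, along the restriction maps. -/
def Completion (M : RICFunctor.{u, w} R Υ) : Type (max u w) :=
  Module.DirectLimit (R := R) (ι := Υ.Levelᵒᵈ) (fun K => M.obj (OrderDual.ofDual K))
    (fun _ _ h => M.res h)

open Classical in
noncomputable instance (M : RICFunctor.{u, w} R Υ) : AddCommGroup M.Completion :=
  inferInstanceAs (AddCommGroup (Module.DirectLimit (R := R) (ι := Υ.Levelᵒᵈ)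
    (fun K => M.obj (OrderDual.ofDual K)) (fun _ _ h => M.res h)))

open Classical in
noncomputable instance (M : RICFunctor.{u, w} R Υ) : Module R M.Completion :=
  inferInstanceAs (Module R (Module.DirectLimit (R := R) (ι := Υ.Levelᵒᵈ)
    (fun K => M.obj (OrderDual.ofDual K)) (fun _ _ h => M.res h)))

open Classical in
/-- The natural map `M(K) → M̂`. -/
noncomputable def toCompletion (M : RICFunctor.{u, w} R Υ) (K : Υ.Level) :
    M.obj K →ₗ[R] M.Completion :=
  Module.DirectLimit.of R Υ.Levelᵒᵈ (fun K => M.obj (OrderDual.ofDual K))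
    (fun _ _ h => M.res h) (OrderDual.toDual K)

theorem toCompletion_res (M : RICFunctor.{u, w} R Υ) {L K : Υ.Level} (h : L ≤ K) (x : M.obj K) :
    M.toCompletion L (M.res h x) = M.toCompletion K x := by
  classical
  exact Module.DirectLimit.of_f (R := R) (ι := Υ.Levelᵒᵈ)
    (G := fun K => M.obj (OrderDual.ofDual K)) (f := fun _ _ h => M.res h)
    (i := OrderDual.toDual K) (j := OrderDual.toDual L) (hij := h) (x := x)

theorem completion_hom_ext (M : RICFunctor.{u, w} R Υ) {P : Type*} [AddCommGroup P] [Module R P]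
    {f g : M.Completion →ₗ[R] P}
    (h : ∀ K x, f (M.toCompletion K x) = g (M.toCompletion K x)) : f = g := by
  classical
  exact Module.DirectLimit.hom_ext (R := R) (ι := Υ.Levelᵒᵈ)
    (G := fun K => M.obj (OrderDual.ofDual K)) (f := fun _ _ h => M.res h)
    (fun K => LinearMap.ext fun x => h K x)

/-- The image of `[g]^* x` under `M(g K g⁻¹) → M̂`, for `x ∈ M(K)`. -/
noncomputable def actLevel (M : RICFunctor.{u, w} R Υ) (g : G) (K : Υ.Level) :
    M.obj K →ₗ[R] M.Completion :=
  M.toCompletion (conjLevel g K) ∘ₗ M.pull g (moves_conjLevel g K)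

theorem actLevel_eq (M : RICFunctor.{u, w} R Υ) (g : G) {K L : Υ.Level} (h : Moves g L.1 K.1)
    (x : M.obj K) : M.toCompletion L (M.pull g h x) = M.actLevel g K x := by
  have hle : L ≤ conjLevel g K := fun y hy => mem_conjSub.2 (h y hy)
  unfold actLevel
  rw [LinearMap.comp_apply, ← M.toCompletion_res hle, res,
    M.pull_mul_apply _ _ h (by simp)]

theorem actLevel_res (M : RICFunctor.{u, w} R Υ) (g : G) {K L : Υ.Level} (h : L ≤ K)
    (x : M.obj K) : M.actLevel g L (M.res h x) = M.actLevel g K x := by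
  have h' : Moves g (conjLevel g L).1 K.1 := fun y hy => h (mem_conjSub.1 hy)
  rw [← M.actLevel_eq g h' x, actLevel, LinearMap.comp_apply, res,
    M.pull_mul_apply _ _ h' (by simp)]

open Classical in
/-- The action of `g` on the completion: `g • j_K(x) = j_{gKg⁻¹}([g]^* x)`. -/
noncomputable def act (M : RICFunctor.{u, w} R Υ) (g : G) : M.Completion →ₗ[R] M.Completion :=
  Module.DirectLimit.lift R Υ.Levelᵒᵈ (fun K => M.obj (OrderDual.ofDual K))
    (fun _ _ h => M.res h) (fun K => M.actLevel g (OrderDual.ofDual K))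
    (fun _ _ h x => M.actLevel_res g h x)

theorem act_toCompletion (M : RICFunctor.{u, w} R Υ) (g : G) (K : Υ.Level) (x : M.obj K) :
    M.act g (M.toCompletion K x) = M.actLevel g K x := by
  classical
  exact Module.DirectLimit.lift_of (R := R) (ι := Υ.Levelᵒᵈ)
    (G := fun K => M.obj (OrderDual.ofDual K)) (f := fun _ _ h => M.res h) _ _ x

/-- The inductive completion as a representation of `G`. -/
noncomputable def completionRep (M : RICFunctor.{u, w} R Υ) : Representation R G M.Completion where
  toFun := M.act
  map_one' := by
    refine M.completion_hom_ext fun K x => ?_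
    rw [act_toCompletion, ← M.actLevel_eq 1 (Moves.of_le (le_refl K.1)), M.pull_one]
    rfl
  map_mul' g h := by
    refine M.completion_hom_ext fun K x => ?_
    rw [act_toCompletion, Module.End.mul_apply, act_toCompletion, actLevel, LinearMap.comp_apply,
      actLevel, LinearMap.comp_apply, act_toCompletion, actLevel, LinearMap.comp_apply,
      M.pull_mul_apply _ _ ((moves_conjLevel h K).mul (moves_conjLevel g _)) rfl, M.actLevel_eq]
    exact (M.actLevel_eq (g * h) _ x).symm

/-- The natural map `j_V : M(V) → M̂_Φ`, where `M̂_Φ` is the completion of `Φ ⊗ M`. -/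
noncomputable def toCompletionBC (M : RICFunctor.{u, w} R Υ) (Φ : Type w') [CommRing Φ]
    [Algebra R Φ] (V : Υ.Level) (x : M.obj V) : (M.baseChange Φ).Completion :=
  (M.baseChange Φ).toCompletion V ((1 : Φ) ⊗ₜ[R] x)

theorem moves_heckeCorr {K K' : Υ.Level} (σ : G) :
    Moves σ (infLevel (conjLevel σ K) K').1 (infLevel K (conjLevel σ⁻¹ K')).1 := by
  intro x hx
  refine ⟨mem_conjSub.1 hx.1, mem_conjSub.2 ?_⟩
  simpa [mul_assoc] using hx.2

/-- The Hecke correspondence `[K' σ K] : M(K) → M(K')`, the composite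
`M(K) → M(K ∩ σ⁻¹K'σ) → M(σKσ⁻¹ ∩ K') → M(K')` of `pr^*`, `[σ]^*` and `pr_*`. -/
def heckeCorr (M : RICFunctor.{u, w} R Υ) (K' : Υ.Level) (σ : G) (K : Υ.Level) :
    M.obj K →ₗ[R] M.obj K' :=
  M.ind (infLevel_le_right (conjLevel σ K) K') ∘ₗ
    M.pull σ (moves_heckeCorr σ) ∘ₗ
      M.res (infLevel_le_left K (conjLevel σ⁻¹ K'))

/-- The covariant action `M(U) → M(W)` of `ξ = ∑_h ξ(h) ch(U h W)`, the sum running over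
`U \ G / W`: it is `∑_h ξ(h) [U h W]_*`, where `[U h W]_* = [W h⁻¹ U]`. -/
noncomputable def heckeCov (M : RICFunctor.{u, w} R Υ) (U W : Υ.Level) (ξ : G → R)
    (x : M.obj U) : M.obj W :=
  ∑ᶠ D : DoubleCoset.Quotient (U.1 : Set G) (W.1 : Set G),
    ξ (Quotient.out D) • M.heckeCorr W (Quotient.out D)⁻¹ U x

end RICFunctor

/-! ### Pushforwards and mixed Hecke correspondences -/

section Pushforward

variable {R : Type z} [CommRing R] {H : Type v} [Group H] [TopologicalSpace H] {G : Type u}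
  [Group G] [TopologicalSpace G] {ΥH : LevelSystem H} {ΥG : LevelSystem G}

/-- A pushforward `M_H → M_G` along `ι : H → G`: maps `ι_{U,K,*} : M_H(U) → M_G(K)` for all levels
with `ι(U) ⊆ K`, commuting with the pushforwards `[h]_*` along all morphisms
`h : (V, L) ⟶ (U, K)` of such pairs. -/
structure Pushforward (ι : H →* G) (MH : RICFunctor.{v, w} R ΥH) (MG : RICFunctor.{u, w'} R ΥG) where
  map : ∀ (U : ΥH.Level) (K : ΥG.Level), U.1 ≤ K.1.comap ι → (MH.obj U →ₗ[R] MG.obj K)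
  comm : ∀ (V U : ΥH.Level) (L K : ΥG.Level) (hV : V.1 ≤ L.1.comap ι) (hU : U.1 ≤ K.1.comap ι)
    (h : H) (h1 : Moves h V.1 U.1) (h2 : Moves (ι h) L.1 K.1),
    map U K hU ∘ₗ MH.push h h1 = MG.push (ι h) h2 ∘ₗ map V L hV

/-- The level `H ∩ g K g⁻¹` of `H`. -/
def traceLevel (ι : H →* G) (hΥ : ∀ K ∈ ΥG.carrier, K.comap ι ∈ ΥH.carrier) (g : G)
    (K : ΥG.Level) : ΥH.Level :=
  ⟨(conjSub g K.1).comap ι, hΥ _ (ΥG.conj_mem g K.1 K.2)⟩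

theorem traceLevel_mono (ι : H →* G) (hΥ : ∀ K ∈ ΥG.carrier, K.comap ι ∈ ΥH.carrier) (g : G)
    {L K : ΥG.Level} (h : L ≤ K) : traceLevel ι hΥ g L ≤ traceLevel ι hΥ g K :=
  fun _ hx => mem_conjSub.2 (h (mem_conjSub.1 hx))

/-- The mixed Hecke correspondence `[V σ K]_* : M_H(V) → M_G(K)`, the composite
`M_H(V) → M_H(V ∩ σKσ⁻¹) → M_G(σKσ⁻¹) → M_G(K)` of `pr^*`, `ι_*` and `[σ]_*`. -/
def mixedHecke {ι : H →* G} (hΥ : ∀ K ∈ ΥG.carrier, K.comap ι ∈ ΥH.carrier)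
    {MH : RICFunctor.{v, w} R ΥH} {MG : RICFunctor.{u, w'} R ΥG} (p : Pushforward ι MH MG)
    (V : ΥH.Level) (σ : G) (K : ΥG.Level) : MH.obj V →ₗ[R] MG.obj K :=
  MG.push σ (moves_conjLevel σ K) ∘ₗ
    p.map (infLevel V (traceLevel ι hΥ σ K)) (conjLevel σ K)
      (infLevel_le_right V (traceLevel ι hΥ σ K)) ∘ₗ
      MH.res (infLevel_le_left V (traceLevel ι hΥ σ K))

end Pushforward

/-! ### Function spaces and Hecke operators -/

section Functions

variable {H : Type v} [Group H] {G : Type u} [Group G] [TopologicalSpace G]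

/-- `C(G/K, τ)`: compactly supported functions `G → τ` that are right `K`-invariant. -/
def funSpace (Φ : Type w) [CommRing Φ] (K : Subgroup G) (τ : Type w') [AddCommGroup τ]
    [Module Φ τ] : Submodule Φ (G → τ) where
  carrier := {ξ | HasCompactSupport ξ ∧ ∀ g, ∀ k ∈ K, ξ (g * k) = ξ g}
  zero_mem' := ⟨HasCompactSupport.zero, fun _ _ _ => rfl⟩
  add_mem' := fun {a b} ha hb => ⟨HasCompactSupport.add ha.1 hb.1, fun g k hk => by
    simp only [Pi.add_apply, ha.2 g k hk, hb.2 g k hk]⟩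
  smul_mem' := fun c a ha => ⟨ha.1.mono (fun x hx hx' => hx (by simp [hx'])), fun g k hk => by
    simp only [Pi.smul_apply, ha.2 g k hk]⟩

/-- The action of `H` on `C(G/K, τ)`, `(h ξ)(g) = h • ξ(ι(h)⁻¹ g)`. -/
def funRep [IsTopologicalGroup G] {Φ : Type w} [CommRing Φ] (ι : H →* G) (K : Subgroup G)
    {τ : Type w'} [AddCommGroup τ] [Module Φ τ] (ρ : Representation Φ H τ) :
    Representation Φ H (funSpace Φ K τ) where
  toFun h :=
    { toFun := fun ξ => ⟨fun g => ρ h (ξ.1 ((ι h)⁻¹ * g)), by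
        refine ⟨?_, fun g k hk => ?_⟩
        · have h1 : HasCompactSupport (fun g => ξ.1 ((ι h)⁻¹ * g)) :=
            ξ.2.1.comp_homeomorph (Homeomorph.mulLeft (ι h)⁻¹)
          exact h1.comp_left (map_zero (ρ h))
        · change ρ h (ξ.1 ((ι h)⁻¹ * (g * k))) = ρ h (ξ.1 ((ι h)⁻¹ * g))
          rw [← mul_assoc, ξ.2.2 _ k hk]⟩
      map_add' := fun a b => by ext g; simp
      map_smul' := fun c a => by ext g; simp }
  map_one' := by ext ξ g; simp
  map_mul' a b := by ext ξ g; simp [mul_assoc]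

/-- `C_O(K \ G / K)`: compactly supported `K`-bi-invariant functions `G → O`. For `K` compact open
this is the free `O`-module on the characteristic functions of double cosets. -/
def heckeSpace (O : Type w) [CommRing O] (K : Subgroup G) : Submodule O (G → O) where
  carrier := {ξ | HasCompactSupport ξ ∧ ∀ k ∈ K, ∀ k' ∈ K, ∀ g, ξ (k * g * k') = ξ g}
  zero_mem' := ⟨HasCompactSupport.zero, fun _ _ _ _ _ => rfl⟩
  add_mem' := fun {a b} ha hb => ⟨HasCompactSupport.add ha.1 hb.1, fun k hk k' hk' g => by
    simp only [Pi.add_apply, ha.2 k hk k' hk' g, hb.2 k hk k' hk' g]⟩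
  smul_mem' := fun c a ha => ⟨ha.1.mono (fun x hx hx' => hx (by simp [hx'])), fun k hk k' hk' g => by
    simp only [Pi.smul_apply, ha.2 k hk k' hk' g]⟩

/-- The function `x ⊗ ξ : g ↦ ξ(g) x` in `C(G/K, τ)`. -/
def tensorFun {O : Type z} [CommRing O] {Φ : Type w} [CommRing Φ] [Algebra O Φ] {K : Subgroup G}
    {τ : Type w'} [AddCommGroup τ] [Module Φ τ] (x : τ) (ξ : heckeSpace O K) :
    funSpace Φ K τ :=
  ⟨fun g => algebraMap O Φ (ξ.1 g) • x, by
    refine ⟨ξ.2.1.mono (fun g hg hg' => hg ?_), fun g k hk => ?_⟩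
    · simp only [hg', map_zero, zero_smul]
    · have := ξ.2.2 1 K.one_mem k hk g
      rw [one_mul] at this
      simp only [this]⟩

open Classical in
/-- The function `y ⊗ ch(gK)`: it is `y` on `gK` and `0` elsewhere. -/
noncomputable def cosetFun (K : Subgroup G) {τ : Type w'} [AddCommGroup τ] (y : τ) (g : G) : G → τ :=
  fun g' => if g⁻¹ * g' ∈ K then y else 0

/-- The `(H, g)`-restriction `h ↦ ξ(ι(h) g)` of a function `ξ` on `G`. -/
def twistedRes {O : Type z} (ι : H →* G) (ξ : G → O) (g : G) : H → O :=
  fun h => ξ (ι h * g)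

/-- The transpose `h ↦ ξ(h⁻¹)`. -/
def transposeFun {O : Type z} (ξ : H → O) : H → O :=
  fun h => ξ h⁻¹

/-- The action `ξ • x = ∫ ξ(h) h x dμ(h) = ∑_{hU ∈ H/U} ξ(h) h x` of a compactly supported right
`U`-invariant function `ξ` on a `U`-invariant vector `x`, for the Haar measure `μ` on `H` that is
normalized by `μ(U) = 1`. -/
noncomputable def heckeAct {O : Type z} [CommRing O] {Φ : Type w} [CommRing Φ] [Algebra O Φ]
    {τ : Type w'} [AddCommGroup τ] [Module Φ τ] (ρ : Representation Φ H τ) (U : Subgroup H)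
    (ξ : H → O) (x : τ) : τ :=
  ∑ᶠ c : H ⧸ U, algebraMap O Φ (ξ c.out) • ρ c.out x

/-- The set `H \ (H · supp ξ) / K` of double cosets `HgK` that meet the support of `ξ`. -/
abbrev SuppClasses {O : Type z} [Zero O] (ι : H →* G) (ξ : G → O) (K : Subgroup G) : Type u :=
  {α : DoubleCoset.Quotient (ι.range : Set G) (K : Set G) //
    ∃ g, ξ g ≠ 0 ∧ DoubleCoset.mk ι.range K g = α}

/-- A compactly supported function meets only finitely many double cosets. -/
theorem finite_suppClasses [IsTopologicalGroup G] {O : Type z} [Zero O] (ι : H →* G) {ξ : G → O}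
    {K : Subgroup G} (hK : IsOpen (K : Set G)) (hξ : HasCompactSupport ξ) :
    Finite (SuppClasses ι ξ K) := by
  obtain ⟨t, ht⟩ := hξ.isCompact.elim_finite_subcover (fun g : G => (fun x => g⁻¹ * x) ⁻¹' (K : Set G))
    (fun g => hK.preimage (continuous_const_mul g⁻¹))
    (fun x _ => Set.mem_iUnion.2 ⟨x, by simp⟩)
  have : {α : DoubleCoset.Quotient (ι.range : Set G) (K : Set G) |
      ∃ g, ξ g ≠ 0 ∧ DoubleCoset.mk ι.range K g = α} ⊆ (DoubleCoset.mk ι.range K) '' (t : Set G) := by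
    rintro α ⟨g, hg, rfl⟩
    obtain ⟨a, ha, hga⟩ := Set.mem_iUnion₂.1 (ht (subset_tsupport ξ hg))
    refine ⟨a, ha, ?_⟩
    rw [DoubleCoset.eq]
    exact ⟨1, ι.range.one_mem, a⁻¹ * g, hga, by simp⟩
  exact ((t.finite_toSet.image _).subset this).to_subtype

end Functions

/-! ### Zeta elements -/

section Zeta

variable {H : Type v} [Group H] [TopologicalSpace H] {G : Type u} [Group G] [TopologicalSpace G]
  {ΥH : LevelSystem H} {ΥG : LevelSystem G} {O : Type z} [CommRing O]

/-- `ξ : G → M̂_{H,Φ}` is `O`-integral at level `L`: each value `ξ(g)` is a finite sum of terms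
`[U : V_i] j_{V_i}(x_i)` with `V_i ⊆ g L g⁻¹` and `x_i ∈ M_H(V_i)`. -/
def IsIntegralAt {Φ : Type t} [Field Φ] [Algebra O Φ] (ι : H →* G) (MH : RICFunctor.{v, w} O ΥH)
    (U : ΥH.Level) (L : ΥG.Level) (ξ : G → (MH.baseChange Φ).Completion) : Prop :=
  ∀ g : G, ∃ (n : ℕ) (V : Fin n → ΥH.Level) (_ : ∀ i, (V i).1 ≤ (conjSub g L.1).comap ι)
    (x : ∀ i, MH.obj (V i)),
    ξ g = ∑ i, (genIndex U.1 (V i).1 : Φ) • MH.toCompletionBC Φ (V i) (x i)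

/-- A zeta element for `(x_U, ℌ, L)` with coefficients in `Φ`: an element of `C(G/K, M̂_{H,Φ})` that
is `O`-integral at level `L` and has the same class in the `H`-coinvariants as `j_U(x_U) ⊗ ℌ`. -/
def IsZetaElement [IsTopologicalGroup G] {Φ : Type t} [Field Φ] [Algebra O Φ] (ι : H →* G)
    (MH : RICFunctor.{v, w} O ΥH) (U : ΥH.Level) (K L : ΥG.Level) (xU : MH.obj U)
    (Hp : heckeSpace O K.1) (ζ : funSpace Φ K.1 (MH.baseChange Φ).Completion) : Prop :=
  IsIntegralAt ι MH U L ζ.1 ∧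
    Representation.Coinvariants.mk (funRep ι K.1 (MH.baseChange Φ).completionRep) ζ =
      Representation.Coinvariants.mk (funRep ι K.1 (MH.baseChange Φ).completionRep)
        (tensorFun (MH.toCompletionBC Φ U xU) Hp)

/-- `y ∈ M_G(L)` is a class associated with `ζ` under the pushforward `p`: for some presentation
`ζ = ∑_i [U : V_i] j_{V_i}(x_i) ⊗ ch(g_i K)` with `V_i ⊆ g_i L g_i⁻¹` and `x_i ∈ M_H(V_i)`, one has
`y = ∑_i [V_i g_i L]_*(x_i)`. -/
def IsAssociatedClass {Φ : Type t} [Field Φ] [Algebra O Φ] {ι : H →* G}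
    (hΥ : ∀ K ∈ ΥG.carrier, K.comap ι ∈ ΥH.carrier) {MH : RICFunctor.{v, w} O ΥH}
    {MG : RICFunctor.{u, w'} O ΥG} (p : Pushforward ι MH MG) (U : ΥH.Level) (K L : ΥG.Level)
    (ζ : G → (MH.baseChange Φ).Completion) (y : MG.obj L) : Prop :=
  ∃ (n : ℕ) (g : Fin n → G) (V : Fin n → ΥH.Level)
    (_ : ∀ i, (V i).1 ≤ (conjSub (g i) L.1).comap ι) (x : ∀ i, MH.obj (V i)),
    ζ = ∑ i, cosetFun K.1 ((genIndex U.1 (V i).1 : Φ) • MH.toCompletionBC Φ (V i) (x i)) (g i) ∧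
    y = ∑ i, mixedHecke hΥ p (V i) (g i) L (x i)

end Zeta

/-!
Write `W_g = H ∩ gKg⁻¹`. The argument computes the `H`-coinvariants of `C(G/K, M̂)` over the field
`Φ`, one double coset `HgK` at a time.

For a cohomological functor over a field of characteristic zero, the maps `[W : X]⁻¹ pr_* pr^*`
through small levels `X ⊆ W` are compatible and define an averaging map `E_W : M̂ → M(W)`
(`RICFunctor.IsCohomological.average`). It is invariant under `W` and a left inverse of
`j_W : M(W) → M̂`, and by the Mackey formula `j_W ∘ E_W` is the projection to the `W`-invariants
(`RICFunctor.IsCoMack.exists_toCompletion_average`). Summing over cosets gives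
`Λ_g(ξ) = ∑_{h ∈ H / W_g} E_{W_g}(h⁻¹ ξ(h g))` (`orbitAverage`). It is unchanged by the action of
`H` on `ξ` (`orbitAverage_funRep`), and the values `Λ_g(ξ)` at representatives of the double cosets
that meet the support of `ξ` determine the class of `ξ` in the coinvariants
(`mk_eq_sum_mk_orbitAverage`).

Two computations then give the theorem, and both rest on unimodularity. Comparing
multiplicities of double cosets in `U \ H / W_g` yields
`Λ_g(j_U(x_U) ⊗ ℌ) = [U : W_g] E_{W_g}(𝔥^t · j_U(x_U))` (`orbitAverage_tensorFun`), where the Hecke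
action `𝔥^t · j_U(x_U)` equals `j_{W_g}(𝔥_* x_U)` (`heckeAct_toCompletionBC`). On the other hand,
`Λ_g` sends an integral term `[U : V] j_V(x) ⊗ ch(g'K)` with `g' = h g k` to `[U : W_g]` times the
induction of `[h]_* x ∈ M_H(H ∩ gLg⁻¹)` (`genIndex_smul_average`); normality of `L` in `K` makes
`h` a morphism to this level. So the criterion says exactly that `Λ_g(j_U(x_U) ⊗ ℌ)` is `Λ_g` of an
integral function. The norm relation up to torsion follows because `M → Φ ⊗ M` has the torsion as
its kernel (`one_tmul_eq_zero_iff_mem_torsion`).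

For an associated class, the same classes `[h]_* x` describe the pushforward term by term
(`ind_mixedHecke`). The terms on double cosets outside the support of `ℌ` have `Λ_g = 0`; if `M_H`
is torsion free, the induction to `W_g` of their sum already vanishes in `M_H(W_g)`, so they do not
contribute.
-/

/-! ### Indices of levels -/

section Indices

open MeasureTheory

variable {G : Type u} [Group G]

theorem conjSub_relIndex_conjSub (g : G) (V W : Subgroup G) :
    (conjSub g V).relIndex (conjSub g W) = V.relIndex W := by
  rw [conjSub, conjSub, ← Subgroup.relIndex_comap,
    Subgroup.comap_map_eq_self_of_injective (MulAut.conj g).injective]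

theorem conjSub_mul (g h : G) (V : Subgroup G) : conjSub (g * h) V = conjSub g (conjSub h V) := by
  ext x
  simp [mem_conjSub, mul_assoc]

theorem conjSub_of_mem {g : G} {V : Subgroup G} (hg : g ∈ V) : conjSub g V = V := by
  ext x
  rw [mem_conjSub, V.mul_mem_cancel_right hg, V.mul_mem_cancel_left (V.inv_mem hg)]

theorem Moves.conjSub_inv_le {g : G} {V W : Subgroup G} (h : Moves g V W) :
    conjSub g⁻¹ V ≤ W := by
  intro x hx
  have := h _ (mem_conjSub.1 hx)
  simpa [mul_assoc] using this

theorem genIndex_of_le {V W : Subgroup G} (h : V ≤ W) : genIndex W V = V.relIndex W := by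
  rw [genIndex, Subgroup.relIndex_eq_one.2 h]
  simp

variable [TopologicalSpace G] [IsTopologicalGroup G] [LocallyCompactSpace G]

/-- In a unimodular group, conjugate compact subgroups have the same Haar measure. -/
theorem IsUnimodular.haar_conjSub [MeasurableSpace G] [BorelSpace G] (hG : IsUnimodular G) (g : G)
    {V : Subgroup G} (hV : IsCompact (V : Set G)) (hVo : IsOpen (V : Set G)) :
    (Measure.haar : Measure G) (conjSub g V : Set G) = Measure.haar (V : Set G) := by
  have hright : Measure.map (· * g) (Measure.haar : Measure G) (V : Set G) =
      Measure.haar (V : Set G) := by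
    rw [Measure.measure_isMulInvariant_eq_smul_of_isCompact_closure _
      (Measure.haar : Measure G) (by rwa [(V.isClosed_of_isOpen hVo).closure_eq]),
      ← Measure.modularCharacterFun_eq_haarScalarFactor]
    have h1 : Measure.modularCharacterFun g = 1 := DFunLike.congr_fun hG g
    rw [h1, one_smul]
  have hset : (conjSub g V : Set G) = (fun x => g⁻¹ * x) ⁻¹' ((· * g) ⁻¹' (V : Set G)) := by
    ext x
    simp [mem_conjSub]
  rw [hset, measure_preimage_mul, ← hright, Measure.map_apply (measurable_mul_const g)
    hVo.measurableSet]

variable {Υ : LevelSystem G}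

theorem relIndex_ne_zero (V W : Υ.Level) : V.1.relIndex W.1 ≠ 0 := by
  borelize G
  exact (haar_relIndex (Measure.haar : Measure G) (Υ.isCompact _ W.2) (Υ.isOpen _ V.2)
    (Υ.isOpen _ W.2)).1

/-- The volume of a level for a fixed Haar measure. -/
theorem IsUnimodular.exists_volume (hG : IsUnimodular G) (Υ : LevelSystem G) :
    ∃ vol : Υ.Level → ℝ, (∀ V, vol V ≠ 0) ∧
      (∀ V W, (genIndex V.1 W.1 : ℝ) = vol V / vol W) ∧ ∀ g V, vol (conjLevel g V) = vol V := by
  borelize G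
  refine ⟨fun V => Measure.haar.real (V.1 : Set G), fun V => ?_, fun V W => ?_, fun g V => ?_⟩
  · refine (ENNReal.toReal_pos ?_ (Υ.isCompact _ V.2).measure_lt_top.ne).ne'
    exact ((Υ.isOpen _ V.2).measure_pos _ ⟨1, V.1.one_mem⟩).ne'
  · exact genIndex_eq_haar _ (Υ.isCompact _ V.2) (Υ.isOpen _ V.2) (Υ.isCompact _ W.2)
      (Υ.isOpen _ W.2)
  · exact congrArg ENNReal.toReal (hG.haar_conjSub g (Υ.isCompact _ V.2) (Υ.isOpen _ V.2))

/-- `[U : V] [W : g⁻¹Vg]⁻¹ = [U : W]`, since `V` and `g⁻¹Vg` have the same volume. -/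
theorem IsUnimodular.genIndex_mul_inv_relIndex (hG : IsUnimodular G) (U V W : Υ.Level) {g : G}
    (h : Moves g V.1 W.1) :
    genIndex U.1 V.1 * ((conjSub g⁻¹ V.1).relIndex W.1 : ℚ)⁻¹ = genIndex U.1 W.1 := by
  obtain ⟨vol, h0, hvol, hconj⟩ := hG.exists_volume Υ
  rw [← genIndex_of_le h.conjSub_inv_le]
  have e := hvol W (conjLevel g⁻¹ V)
  rw [hconj] at e
  have h1 := h0 U
  have h2 := h0 V
  have h3 := h0 W
  rw [← Rat.cast_inj (α := ℝ)]
  push_cast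
  rw [show (genIndex W.1 (conjSub g⁻¹ V.1) : ℝ) = _ from e, hvol, hvol]
  field_simp

/-- `[U : U ∩ gWg⁻¹] = [U : W] [W : W ∩ g⁻¹Ug]`, since the two intersections are conjugate. -/
theorem IsUnimodular.relIndex_conjSub_swap (hG : IsUnimodular G) (U W : Υ.Level) (g : G) :
    ((conjSub g W.1).relIndex U.1 : ℚ) =
      genIndex U.1 W.1 * ((conjSub g⁻¹ U.1).relIndex W.1 : ℚ) := by
  obtain ⟨vol, h0, hvol, hconj⟩ := hG.exists_volume Υ
  have e := hvol W (conjLevel g⁻¹ U)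
  rw [hconj] at e
  have e2 : W.1.relIndex (conjSub g⁻¹ U.1) = (conjSub g W.1).relIndex U.1 := by
    rw [← conjSub_relIndex_conjSub g, ← conjSub_mul, mul_inv_cancel,
      conjSub_of_mem U.1.one_mem]
  have h4 : ((conjSub g W.1).relIndex U.1 : ℝ) ≠ 0 :=
    Nat.cast_ne_zero.2 (relIndex_ne_zero (conjLevel g W) U)
  have e3 : (genIndex W.1 (conjSub g⁻¹ U.1) : ℝ) =
      ((conjSub g⁻¹ U.1).relIndex W.1 : ℝ) / ((conjSub g W.1).relIndex U.1 : ℝ) := by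
    rw [genIndex, e2]
    push_cast
    rfl
  have h1 := h0 U
  have h3 := h0 W
  have e5 := e3.symm.trans e
  rw [← Rat.cast_inj (α := ℝ)]
  push_cast
  rw [hvol]
  field_simp at e5 ⊢
  linarith

end Indices

/-! ### Torsion and extension of scalars to a field -/

/-- The kernel of `M → Φ ⊗ M` is the torsion: localization at the non-zero elements followed by
the faithfully flat extension of the fraction field to `Φ`. -/
theorem one_tmul_eq_zero_iff_mem_torsion {O : Type z} [CommRing O] [IsDomain O] {Φ : Type t}
    [Field Φ] [Algebra O Φ] (hΦ : Function.Injective (algebraMap O Φ)) {M : Type w}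
    [AddCommGroup M] [Module O M] (m : M) :
    (1 : Φ) ⊗ₜ[O] m = 0 ↔ m ∈ Submodule.torsion O M := by
  have : FaithfulSMul O Φ := (faithfulSMul_iff_algebraMap_injective O Φ).2 hΦ
  let F := FractionRing O
  let : Algebra F Φ := FractionRing.liftAlgebra O Φ
  have : IsScalarTower O F Φ := FractionRing.isScalarTower_liftAlgebra O Φ
  have h1 : (1 : Φ) ⊗ₜ[O] m = 0 ↔ (1 : Φ) ⊗ₜ[F] ((1 : F) ⊗ₜ[O] m) = 0 := by
    rw [← (TensorProduct.AlgebraTensorModule.cancelBaseChange O F Φ Φ M).map_eq_zero_iff,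
      TensorProduct.AlgebraTensorModule.cancelBaseChange_tmul, one_smul]
  have h2 : (1 : Φ) ⊗ₜ[F] ((1 : F) ⊗ₜ[O] m) = 0 ↔ (1 : F) ⊗ₜ[O] m = 0 := by
    have := Module.FaithfullyFlat.tensorProduct_mk_injective (A := F) (B := Φ) (F ⊗[O] M)
    exact map_eq_zero_iff (TensorProduct.mk F Φ (F ⊗[O] M) 1) this
  have h3 : IsLocalizedModule (nonZeroDivisors O) (TensorProduct.mk O F M 1) :=
    (isLocalizedModule_iff_isBaseChange (nonZeroDivisors O) F _).2 (TensorProduct.isBaseChange O M F)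
  rw [h1, h2, Submodule.mem_torsion_iff]
  exact IsLocalizedModule.eq_zero_iff (nonZeroDivisors O) (TensorProduct.mk O F M 1)

/-! ### Sums over cosets and double cosets -/

section Cosets

variable {H : Type v} [Group H] {M : Type w} [AddCommGroup M]

/-- Summation along the fibres of a map, for a function that is constant on them. -/
theorem finsum_eq_finsum_card_fiber_nsmul {X : Type*} {Y : Type*} (q : X → Y) (F : Y → M)
    (hq : ∀ y, (q ⁻¹' {y}).Finite) (hq' : Function.Surjective q)
    (hf : (Function.support fun x => F (q x)).Finite) :
    ∑ᶠ x, F (q x) = ∑ᶠ y, (q ⁻¹' {y}).ncard • F y := by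
  classical
  have hF : (Function.support F).Finite := by
    refine (hf.image q).subset fun y hy => ?_
    obtain ⟨x, rfl⟩ := hq' y
    exact ⟨x, hy, rfl⟩
  rw [finsum_eq_sum_of_support_subset (s := hF.toFinset) (fun y => (q ⁻¹' {y}).ncard • F y)
      (fun y hy => by
        simp only [Set.Finite.coe_toFinset, Function.mem_support]
        rintro h
        simp [h] at hy),
    finsum_eq_sum_of_support_subset (s := hf.toFinset) _ (by simp),
    ← Finset.sum_fiberwise_of_maps_to (s := hf.toFinset) (t := hF.toFinset) (g := q)
      (fun x hx => by simpa using hx)]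
  refine Finset.sum_congr rfl fun y hy => ?_
  have hy' : F y ≠ 0 := by simpa using hy
  rw [Finset.sum_congr rfl (g := fun _ => F y) (fun x hx => by
    rw [(Finset.mem_filter.1 hx).2]), Finset.sum_const, Set.ncard_eq_toFinset_card _ (hq y)]
  congr 2
  ext x
  simp only [Finset.mem_filter, Set.Finite.mem_toFinset, Function.mem_support, Set.mem_preimage,
    Set.mem_singleton_iff]
  exact ⟨fun h => h.2, fun h => ⟨by rwa [h], h⟩⟩

theorem sum_eq_finsum_subtype_fiber {I B M : Type*} [Fintype I] [AddCommMonoid M] (q : I → B)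
    (T : I → M) (P : B → Prop) (hP : ∀ b, ¬ P b → ∑ᶠ (i) (_ : q i = b), T i = 0) :
    ∑ i, T i = ∑ᶠ b : {b // P b}, ∑ᶠ (i) (_ : q i = b.1), T i := by
  classical
  have hF : ∀ b, ∑ᶠ (i) (_ : q i = b), T i = ∑ i with q i = b, T i := by
    intro b
    rw [finsum_eq_sum_of_fintype, Finset.sum_filter]
    exact Finset.sum_congr rfl fun i _ => finsum_eq_if
  rw [show ∑ᶠ b : {b // P b}, ∑ᶠ (i) (_ : q i = b.1), T i =
      ∑ᶠ b ∈ {b | P b}, ∑ᶠ (i) (_ : q i = b), T i from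
    finsum_set_coe_eq_finsum_mem (f := fun b => ∑ᶠ (i) (_ : q i = b), T i) {b | P b},
    finsum_mem_def, Set.indicator_eq_self.2]
  · rw [finsum_eq_sum_of_support_subset (s := Finset.univ.image q),
      Finset.sum_congr rfl fun b _ => hF b,
      Finset.sum_fiberwise_of_maps_to fun i _ => Finset.mem_image_of_mem q (Finset.mem_univ i)]
    intro b hb
    rw [Function.mem_support, hF] at hb
    obtain ⟨i, hi, -⟩ := Finset.exists_ne_zero_of_sum_ne_zero hb
    exact Finset.mem_coe.2 (Finset.mem_image.2 ⟨i, Finset.mem_univ i, (Finset.mem_filter.1 hi).2⟩)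
  · exact fun b hb => by_contra fun h => hb (hP b h)

/-- The orbit of `dB` in `H ⧸ B` under `A` has `[A : A ∩ dBd⁻¹]` elements. -/
theorem ncard_orbit_eq_relIndex (A B : Subgroup H) (d : H) :
    (MulAction.orbit A (d : H ⧸ B)).ncard = (conjSub d B).relIndex A := by
  rw [← MulAction.index_stabilizer]
  congr 1
  ext a
  rw [MulAction.mem_stabilizer_iff, Subgroup.mem_subgroupOf, mem_conjSub]
  change ((a.1 * d : H) : H ⧸ B) = d ↔ _
  rw [eq_comm, QuotientGroup.eq, mul_assoc]

theorem finite_orbit_of_relIndex {A B : Subgroup H} {d : H} (h : (conjSub d B).relIndex A ≠ 0) :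
    (MulAction.orbit A (d : H ⧸ B)).Finite :=
  Set.finite_of_ncard_ne_zero (by rwa [ncard_orbit_eq_relIndex])

theorem apply_out_of_right_invariant {X : Type*} {B : Subgroup H} (f : H → X)
    (hf : ∀ h, ∀ b ∈ B, f (h * b) = f h) (h : H) : f (h : H ⧸ B).out = f h := by
  obtain ⟨b, hb⟩ := QuotientGroup.mk_out_eq_mul B h
  rw [hb, hf h b.1 b.2]

theorem apply_out_of_biinvariant {X : Type*} {A B : Subgroup H} (f : H → X)
    (hA : ∀ a ∈ A, ∀ h, f (a * h) = f h) (hB : ∀ h, ∀ b ∈ B, f (h * b) = f h) (h : H) :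
    f (Quotient.out (DoubleCoset.mk A B h)) = f h := by
  obtain ⟨a, b, ha, hb, e⟩ := DoubleCoset.mk_out_eq_mul A B h
  exact (congrArg f e).trans (by rw [hB _ b hb, hA a ha])

/-- A sum over `H ⧸ B` of an `A`-invariant function, as a sum over `A \ H / B`. -/
theorem finsum_quotient_eq_finsum_doubleCoset {A B : Subgroup H} (f : H → M)
    (hfin : ∀ d, (conjSub d B).relIndex A ≠ 0)
    (hA : ∀ a ∈ A, ∀ h, f (a * h) = f h) (hB : ∀ h, ∀ b ∈ B, f (h * b) = f h)
    (hf : (Function.support fun c : H ⧸ B => f c.out).Finite) :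
    ∑ᶠ c : H ⧸ B, f c.out =
      ∑ᶠ D : DoubleCoset.Quotient (A : Set H) (B : Set H),
        (conjSub (Quotient.out D) B).relIndex A • f (Quotient.out D) := by
  let q : H ⧸ B → DoubleCoset.Quotient (A : Set H) (B : Set H) := fun c => DoubleCoset.mk A B c.out
  have hq : ∀ c : H ⧸ B, f (Quotient.out (q c)) = f c.out := fun c =>
    apply_out_of_biinvariant f hA hB _
  have hfib : ∀ D, q ⁻¹' {D} = MulAction.orbit A ((Quotient.out D : H) : H ⧸ B) := by
    intro D
    ext c
    rw [Set.mem_preimage, Set.mem_singleton_iff, MulAction.mem_orbit_iff]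
    conv_lhs => rw [← DoubleCoset.out_eq' A B D, eq_comm, DoubleCoset.eq]
    constructor
    · rintro ⟨a, ha, b, hb, e⟩
      refine ⟨⟨a, ha⟩, ?_⟩
      change ((a * Quotient.out D : H) : H ⧸ B) = c
      rw [← QuotientGroup.out_eq' c, e, QuotientGroup.eq]
      simpa [mul_assoc] using hb
    · rintro ⟨a, rfl⟩
      obtain ⟨b, hb⟩ := QuotientGroup.mk_out_eq_mul B (a.1 * Quotient.out D)
      exact ⟨a.1, a.2, b.1, b.2, hb⟩
  rw [finsum_congr (fun c => (hq c).symm), finsum_eq_finsum_card_fiber_nsmul q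
    (fun D => f (Quotient.out D))]
  · refine finsum_congr fun D => ?_
    rw [hfib, ncard_orbit_eq_relIndex]
  · intro D
    rw [hfib]
    exact finite_orbit_of_relIndex (hfin _)
  · intro D
    obtain ⟨b, hb⟩ := QuotientGroup.mk_out_eq_mul B (Quotient.out D : H)
    refine ⟨((Quotient.out D : H) : H ⧸ B), ?_⟩
    conv_rhs => rw [← DoubleCoset.out_eq' A B D]
    change DoubleCoset.mk A B _ = _
    rw [eq_comm, DoubleCoset.eq]
    exact ⟨1, A.one_mem, b.1, b.2, by rw [hb, one_mul]⟩
  · simpa only [hq] using hf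

/-- A sum over `H ⧸ A` of a function of `h⁻¹`, as a sum over `A \ H / B`. -/
theorem finsum_quotient_inv_eq_finsum_doubleCoset {A B : Subgroup H} (f : H → M)
    (hfin : ∀ d, (conjSub d A).relIndex B ≠ 0)
    (hA : ∀ a ∈ A, ∀ h, f (a * h) = f h) (hB : ∀ h, ∀ b ∈ B, f (h * b) = f h)
    (hf : (Function.support fun c : H ⧸ A => f c.out⁻¹).Finite) :
    ∑ᶠ c : H ⧸ A, f c.out⁻¹ =
      ∑ᶠ D : DoubleCoset.Quotient (A : Set H) (B : Set H),
        (conjSub (Quotient.out D : H)⁻¹ A).relIndex B • f (Quotient.out D) := by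
  let q : H ⧸ A → DoubleCoset.Quotient (A : Set H) (B : Set H) :=
    fun c => DoubleCoset.mk A B c.out⁻¹
  have hq : ∀ c : H ⧸ A, f (Quotient.out (q c)) = f c.out⁻¹ := fun c =>
    apply_out_of_biinvariant f hA hB _
  have hfib : ∀ D, q ⁻¹' {D} = MulAction.orbit B (((Quotient.out D : H)⁻¹ : H) : H ⧸ A) := by
    intro D
    ext c
    rw [Set.mem_preimage, Set.mem_singleton_iff, MulAction.mem_orbit_iff]
    conv_lhs => rw [← DoubleCoset.out_eq' A B D, eq_comm, DoubleCoset.eq]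
    constructor
    · rintro ⟨a, ha, b, hb, e⟩
      refine ⟨⟨b⁻¹, B.inv_mem hb⟩, ?_⟩
      change ((b⁻¹ * (Quotient.out D : H)⁻¹ : H) : H ⧸ A) = c
      rw [← QuotientGroup.out_eq' c, ← inv_inv (Quotient.out c), e, QuotientGroup.eq]
      simpa [mul_assoc] using ha
    · rintro ⟨b, rfl⟩
      obtain ⟨a, ha⟩ := QuotientGroup.mk_out_eq_mul A (b.1 * (Quotient.out D : H)⁻¹)
      refine ⟨a.1⁻¹, A.inv_mem a.2, b.1⁻¹, B.inv_mem b.2, ?_⟩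
      change (Quotient.out ((b.1 * (Quotient.out D : H)⁻¹ : H) : H ⧸ A))⁻¹ = _
      rw [ha]
      simp [mul_assoc]
  rw [finsum_congr (fun c => (hq c).symm), finsum_eq_finsum_card_fiber_nsmul q
    (fun D => f (Quotient.out D))]
  · refine finsum_congr fun D => ?_
    rw [hfib, ncard_orbit_eq_relIndex]
  · intro D
    rw [hfib]
    exact finite_orbit_of_relIndex (hfin _)
  · intro D
    obtain ⟨a, ha⟩ := QuotientGroup.mk_out_eq_mul A (Quotient.out D : H)⁻¹
    refine ⟨(((Quotient.out D : H)⁻¹ : H) : H ⧸ A), ?_⟩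
    conv_rhs => rw [← DoubleCoset.out_eq' A B D]
    change DoubleCoset.mk A B _ = _
    rw [DoubleCoset.eq]
    exact ⟨a.1, a.2, 1, B.one_mem, by rw [ha]; simp⟩
  · simpa only [hq] using hf

end Cosets

/-! ### Averaging over a level -/

namespace RICFunctor

section Maps

variable {R : Type z} [CommRing R] {G : Type u} [Group G] [TopologicalSpace G] {Υ : LevelSystem G}
  (M : RICFunctor.{u, w} R Υ)

theorem push_mul_apply {L' L K : Υ.Level} {g h k : G} (hg : Moves g L.1 K.1)
    (hh : Moves h L'.1 L.1) (hk : Moves k L'.1 K.1) (e : k = h * g) (x : M.obj L') :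
    M.push g hg (M.push h hh x) = M.push k hk x := by
  subst e
  exact (LinearMap.congr_fun (M.push_mul g h hg hh) x).symm

theorem pull_eq_push_of_eq {L K : Υ.Level} {g k : G} (hg : Moves g L.1 K.1) (hk : Moves k K.1 L.1)
    (e : k = g⁻¹) (x : M.obj K) : M.pull g hg x = M.push k hk x := by
  subst e
  exact LinearMap.congr_fun (M.pull_eq_push g hg hk) x

theorem res_res {L' L K : Υ.Level} (h : L ≤ K) (h' : L' ≤ L) (x : M.obj K) :
    M.res h' (M.res h x) = M.res (h'.trans h) x :=
  M.pull_mul_apply _ _ _ (one_mul 1).symm x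

theorem ind_ind {L' L K : Υ.Level} (h : L ≤ K) (h' : L' ≤ L) (x : M.obj L') :
    M.ind h (M.ind h' x) = M.ind (h'.trans h) x :=
  M.push_mul_apply _ _ _ (one_mul 1).symm x

theorem ind_res_of_antisymm {L K : Υ.Level} (h : L ≤ K) (h' : K ≤ L) (x : M.obj K) :
    M.ind h (M.res h x) = x := by
  obtain rfl := le_antisymm h h'
  rw [ind, res, M.push_one, M.pull_one]
  rfl

theorem toCompletion_ind_of_antisymm {L K : Υ.Level} (h : L ≤ K) (h' : K ≤ L) (x : M.obj L) :
    M.toCompletion K (M.ind h x) = M.toCompletion L x := by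
  obtain rfl := le_antisymm h h'
  rw [ind, M.push_one]
  rfl

/-- The completion is the union of the images of the levels below any fixed one. -/
theorem exists_toCompletion (W : Υ.Level) (y : M.Completion) :
    ∃ V ≤ W, ∃ m, M.toCompletion V m = y := by
  classical
  have : Nonempty Υ.Levelᵒᵈ := ⟨OrderDual.toDual W⟩
  have : IsDirectedOrder Υ.Levelᵒᵈ := ⟨fun A B =>
    ⟨OrderDual.toDual (infLevel (OrderDual.ofDual A) (OrderDual.ofDual B)),
      infLevel_le_left _ _, infLevel_le_right _ _⟩⟩
  obtain ⟨V, m, hm⟩ := Module.DirectLimit.exists_of (R := R) (ι := Υ.Levelᵒᵈ)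
    (G := fun K => M.obj (OrderDual.ofDual K)) (f := fun _ _ h => M.res h) y
  refine ⟨infLevel (OrderDual.ofDual V) W, infLevel_le_right _ _, M.res (infLevel_le_left _ _) m, ?_⟩
  rw [M.toCompletion_res]
  exact hm

theorem act_mul_apply (a b : G) (y : M.Completion) : M.act (a * b) y = M.act a (M.act b y) :=
  LinearMap.congr_fun (M.completionRep.map_mul a b) y

theorem act_toCompletion_of_mem {V : Υ.Level} {h : G} (hh : h ∈ V.1) (m : M.obj V) :
    M.act h (M.toCompletion V m) = M.toCompletion V m := by
  have hm : ∀ a ∈ V.1, Moves a V.1 V.1 := fun a ha x hx =>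
    V.1.mul_mem (V.1.mul_mem (V.1.inv_mem ha) hx) ha
  have hh' := V.1.inv_mem hh
  rw [act_toCompletion, ← M.actLevel_eq h (hm h hh), M.pull_eq_push_of_eq _ (hm _ hh') rfl,
    M.push_of_mem V _ hh']
  rfl

variable {M}

/-- The Mackey formula for `pr_{X,W}^* ∘ pr_{V,W,*}` with `X ⊆ V` normal in `W`: in the completion,
induction from `V` to `W` is the sum of the translates by representatives of `W / V`. -/
theorem IsMackey.exists_toCompletion_ind (hM : M.IsMackey) [IsTopologicalGroup G]
    [LocallyCompactSpace G] {V W : Υ.Level} (h : V ≤ W) :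
    ∃ s : Finset G, s.card = V.1.relIndex W.1 ∧ (∀ γ ∈ s, γ ∈ W.1) ∧
      ∀ m, M.toCompletion W (M.ind h m) = ∑ γ ∈ s, M.act γ (M.toCompletion V m) := by
  classical
  obtain ⟨X, hX, hXW, hXn, hXV⟩ := Υ.exists_normal W.1 W.2 V.1 V.2
  have hfi : (V.1.subgroupOf W.1).index ≠ 0 := relIndex_ne_zero V W
  have : (V.1.subgroupOf W.1).FiniteIndex := ⟨hfi⟩
  have hft : Fintype (W.1 ⧸ V.1.subgroupOf W.1) := Fintype.ofFinite _
  let r : W.1 ⧸ V.1.subgroupOf W.1 → G := fun c => c.out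
  have hr : ∀ c d, (∃ v ∈ V.1, r d = r c * v) → c = d := by
    rintro c d ⟨v, hv, e⟩
    rw [← QuotientGroup.out_eq' c, ← QuotientGroup.out_eq' d, QuotientGroup.eq,
      Subgroup.mem_subgroupOf]
    change (r c)⁻¹ * r d ∈ V.1
    rw [e]
    simpa using hv
  have hconj : ∀ γ ∈ W.1, ∀ x ∈ X, γ⁻¹ * x * γ ∈ X := by
    intro γ hγ x hx
    have := hXn.conj_mem ⟨x, hXW hx⟩ hx ⟨γ⁻¹, W.1.inv_mem hγ⟩
    simpa [Subgroup.mem_subgroupOf] using this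
  refine ⟨Finset.univ.image r, ?_, ?_, fun m => ?_⟩
  · rw [Finset.card_image_of_injective _ (fun c d e => hr c d ⟨1, V.1.one_mem, by simp [e]⟩),
      Finset.card_univ, ← Nat.card_eq_fintype_card]
    rfl
  · intro γ hγ
    obtain ⟨c, -, rfl⟩ := Finset.mem_image.1 hγ
    exact c.out.2
  · have hmack := hM W ⟨X, hX⟩ V hXW h (Finset.univ.image r) (by
      intro γ hγ
      obtain ⟨c, -, rfl⟩ := Finset.mem_image.1 hγ
      exact c.out.2) (by
      intro k hk
      refine ⟨r (QuotientGroup.mk ⟨k, hk⟩), ⟨Finset.mem_image_of_mem _ (Finset.mem_univ _), ?_⟩, ?_⟩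
      · obtain ⟨v, hv⟩ := QuotientGroup.mk_out_eq_mul (V.1.subgroupOf W.1) ⟨k, hk⟩
        refine ⟨1, X.one_mem, _, V.1.inv_mem v.2, ?_⟩
        change k = 1 * ((Quotient.out _ : W.1) : G) * _
        rw [hv]
        simp
      · rintro γ ⟨hγ, l, hl, l', hl', rfl⟩
        obtain ⟨c, -, rfl⟩ := Finset.mem_image.1 hγ
        congr 1
        refine (QuotientGroup.out_eq' c).symm.trans (QuotientGroup.eq.2 ?_)
        rw [Subgroup.mem_subgroupOf]
        have := V.1.mul_mem (hXV (hconj _ c.out.2 l hl)) hl'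
        simpa [r, mul_assoc] using this) m
    rw [← M.toCompletion_res (L := ⟨X, hX⟩) hXW, hmack, map_sum]
    refine Finset.sum_congr rfl fun γ hγ => ?_
    have hγW : γ ∈ W.1 := by
      obtain ⟨c, -, rfl⟩ := Finset.mem_image.1 hγ
      exact c.out.2
    have hle : (⟨X, hX⟩ : Υ.Level) ≤ infLevel ⟨X, hX⟩ (conjLevel γ V) := fun x hx =>
      ⟨hx, mem_conjSub.2 (hXV (hconj γ hγW x hx))⟩
    rw [M.toCompletion_ind_of_antisymm _ hle, M.actLevel_eq, M.act_toCompletion]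

end Maps

section Average

variable {F : Type t} [Field F] [CharZero F] {G : Type u} [Group G] [TopologicalSpace G]
  [IsTopologicalGroup G] [LocallyCompactSpace G] {Υ : LevelSystem G} {N : RICFunctor.{u, w} F Υ}

theorem relIndex_cast_ne_zero (F : Type t) [Field F] [CharZero F] (V W : Υ.Level) :
    (V.1.relIndex W.1 : F) ≠ 0 :=
  Nat.cast_ne_zero.2 (relIndex_ne_zero V W)

/-- The normalized composite of restriction and induction does not change when it is computed
through a smaller level. -/
theorem IsCohomological.inv_relIndex_smul_ind_res (hN : N.IsCohomological) {X Y V W : Υ.Level}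
    (hXY : X ≤ Y) (hV : Y ≤ V) (hW : Y ≤ W) (m : N.obj V) :
    (X.1.relIndex W.1 : F)⁻¹ • N.ind (hXY.trans hW) (N.res (hXY.trans hV) m) =
      (Y.1.relIndex W.1 : F)⁻¹ • N.ind hW (N.res hV m) := by
  rw [← N.res_res hV hXY, ← N.ind_ind hW hXY, hN, map_nsmul,
    ← Subgroup.relIndex_mul_relIndex X.1 Y.1 W.1 hXY hW, ← Nat.cast_smul_eq_nsmul F, smul_smul]
  congr 1
  have := relIndex_cast_ne_zero F X Y
  push_cast
  field_simp

/-- On `M(V)`, the averaging map to `M(W)` is `[W : V ∩ W]⁻¹ pr_* pr^*`, through `M(V ∩ W)`. -/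
noncomputable def averageLevel (N : RICFunctor.{u, w} F Υ) (W V : Υ.Level) :
    N.obj V →ₗ[F] N.obj W :=
  ((infLevel V W).1.relIndex W.1 : F)⁻¹ •
    (N.ind (infLevel_le_right V W) ∘ₗ N.res (infLevel_le_left V W))

theorem IsCohomological.averageLevel_eq (hN : N.IsCohomological) {X V W : Υ.Level} (hV : X ≤ V)
    (hW : X ≤ W) (m : N.obj V) :
    N.averageLevel W V m = (X.1.relIndex W.1 : F)⁻¹ • N.ind hW (N.res hV m) :=
  (hN.inv_relIndex_smul_ind_res (fun _ hx => ⟨hV hx, hW hx⟩ : X ≤ infLevel V W) _ _ m).symm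

theorem IsCohomological.averageLevel_res (hN : N.IsCohomological) {V' V W : Υ.Level} (h : V' ≤ V)
    (m : N.obj V) : N.averageLevel W V' (N.res h m) = N.averageLevel W V m := by
  rw [hN.averageLevel_eq (infLevel_le_left V' W) (infLevel_le_right _ _),
    hN.averageLevel_eq ((infLevel_le_left V' W).trans h) (infLevel_le_right _ _), N.res_res]

open Classical in
/-- The averaging map `M̂ → M(W)` of a cohomological functor over a field of characteristic zero:
for a CoMack functor, the composite with `M(W) → M̂` is the projection onto the `W`-invariants,
see `IsCoMack.exists_toCompletion_average`. -/
noncomputable def IsCohomological.average (hN : N.IsCohomological) (W : Υ.Level) :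
    N.Completion →ₗ[F] N.obj W :=
  Module.DirectLimit.lift F Υ.Levelᵒᵈ (fun K => N.obj (OrderDual.ofDual K))
    (fun _ _ h => N.res h) (fun V => N.averageLevel W (OrderDual.ofDual V))
    (fun _ _ h x => hN.averageLevel_res h x)

theorem IsCohomological.average_toCompletion (hN : N.IsCohomological) {X V W : Υ.Level} (hV : X ≤ V)
    (hW : X ≤ W) (m : N.obj V) :
    hN.average W (N.toCompletion V m) = (X.1.relIndex W.1 : F)⁻¹ • N.ind hW (N.res hV m) := by
  classical
  rw [← hN.averageLevel_eq hV hW]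
  exact Module.DirectLimit.lift_of (R := F) (ι := Υ.Levelᵒᵈ)
    (G := fun K => N.obj (OrderDual.ofDual K)) (f := fun _ _ h => N.res h) _ _ m

theorem IsCohomological.average_toCompletion_self (hN : N.IsCohomological) {W : Υ.Level}
    (m : N.obj W) : hN.average W (N.toCompletion W m) = m := by
  rw [hN.average_toCompletion le_rfl le_rfl, N.ind_res_of_antisymm _ le_rfl, Subgroup.relIndex_self]
  simp

theorem IsCohomological.toCompletion_injective (hN : N.IsCohomological) (W : Υ.Level) :
    Function.Injective (N.toCompletion W) :=
  Function.LeftInverse.injective (g := hN.average W) hN.average_toCompletion_self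

theorem IsCohomological.average_act_toCompletion (hN : N.IsCohomological) {V W : Υ.Level} {h : G}
    (hm : Moves h V.1 W.1) (m : N.obj V) :
    hN.average W (N.act h⁻¹ (N.toCompletion V m)) =
      ((conjSub h⁻¹ V.1).relIndex W.1 : F)⁻¹ • N.push h hm m := by
  have hle : conjLevel h⁻¹ V ≤ W := hm.conjSub_inv_le
  have hh : Moves h V.1 (conjLevel h⁻¹ V).1 := fun x hx => mem_conjSub.2 (by simpa [mul_assoc])
  rw [act_toCompletion, actLevel, LinearMap.comp_apply, hN.average_toCompletion le_rfl hle,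
    N.pull_eq_push_of_eq _ hh (inv_inv h).symm, res, N.pull_one, LinearMap.id_apply, ind,
    N.push_mul_apply _ hh hm (mul_one h).symm]
  rfl

theorem IsCohomological.average_act_of_mem (hN : N.IsCohomological) {W : Υ.Level} {t : G}
    (ht : t ∈ W.1) (y : N.Completion) : hN.average W (N.act t y) = hN.average W y := by
  obtain ⟨V, hV, m, rfl⟩ := N.exists_toCompletion W y
  have ht' : t⁻¹ ∈ W.1 := W.1.inv_mem ht
  have hmW : Moves t⁻¹ W.1 W.1 := fun x hx => W.1.mul_mem (W.1.mul_mem (W.1.inv_mem ht') hx) ht'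
  have hm : Moves t⁻¹ V.1 W.1 := fun x hx => hmW x (hV hx)
  have h1 := hN.average_act_toCompletion hm m
  rw [inv_inv] at h1
  rw [h1, hN.average_toCompletion le_rfl hV, res, N.pull_one, LinearMap.id_apply, ind,
    ← N.push_mul_apply hmW (Moves.of_le hV) hm (one_mul _).symm, N.push_of_mem W _ ht']
  have e := conjSub_relIndex_conjSub t V.1 W.1
  rw [conjSub_of_mem ht] at e
  rw [e]
  rfl

/-- `j_W ∘ E_W` is an average over finitely many elements of `W`, which depend on the vector. -/
theorem IsCoMack.exists_toCompletion_average (hN : N.IsCoMack) (W : Υ.Level) (y : N.Completion) :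
    ∃ s : Finset G, s.Nonempty ∧ (∀ γ ∈ s, γ ∈ W.1) ∧
      N.toCompletion W (hN.1.average W y) = (s.card : F)⁻¹ • ∑ γ ∈ s, N.act γ y := by
  obtain ⟨V, hV, m, rfl⟩ := N.exists_toCompletion W y
  obtain ⟨s, hs, hsW, h⟩ := hN.2.exists_toCompletion_ind hV
  refine ⟨s, ?_, hsW, ?_⟩
  · rw [← Finset.card_pos, hs]
    exact Nat.pos_of_ne_zero (relIndex_ne_zero V W)
  · rw [← h, hs, hN.1.average_toCompletion le_rfl hV, map_smul, res, N.pull_one,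
      LinearMap.id_apply]

theorem IsCoMack.toCompletion_average_of_invariant (hN : N.IsCoMack) (W : Υ.Level)
    {y : N.Completion} (hy : ∀ γ ∈ W.1, N.act γ y = y) :
    N.toCompletion W (hN.1.average W y) = y := by
  obtain ⟨s, hs, hsW, h⟩ := hN.exists_toCompletion_average W y
  rw [h, Finset.sum_congr rfl fun γ hγ => hy γ (hsW γ hγ), Finset.sum_const,
    ← Nat.cast_smul_eq_nsmul F, smul_smul, inv_mul_cancel₀, one_smul]
  exact Nat.cast_ne_zero.2 (Finset.card_pos.2 hs).ne'

end Average

section BaseChange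

variable {R : Type z} [CommRing R] {G : Type u} [Group G] [TopologicalSpace G] {Υ : LevelSystem G}
  {M : RICFunctor.{u, w} R Υ} (S : Type w') [CommRing S] [Algebra R S]

theorem baseChange_ind_tmul {L K : Υ.Level} (h : L ≤ K) (s : S) (x : M.obj L) :
    (M.baseChange S).ind h (s ⊗ₜ[R] x : S ⊗[R] M.obj L) = s ⊗ₜ[R] M.ind h x :=
  rfl

theorem baseChange_res_tmul {L K : Υ.Level} (h : L ≤ K) (s : S) (x : M.obj K) :
    (M.baseChange S).res h (s ⊗ₜ[R] x : S ⊗[R] M.obj K) = s ⊗ₜ[R] M.res h x :=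
  rfl

/-- The map `x ↦ 1 ⊗ x` from `M(V)` to the base change of `M` at `V`. -/
noncomputable def baseChangeMk (M : RICFunctor.{u, w} R Υ) (V : Υ.Level) :
    M.obj V →+ (M.baseChange S).obj V :=
  (TensorProduct.mk R S (M.obj V) 1).toAddMonoidHom

theorem toCompletionBC_eq (V : Υ.Level) (x : M.obj V) :
    M.toCompletionBC S V x = (M.baseChange S).toCompletion V (M.baseChangeMk S V x) :=
  rfl

theorem push_baseChangeMk {L K : Υ.Level} (g : G) (h : Moves g L.1 K.1) (x : M.obj L) :
    (M.baseChange S).push g h (M.baseChangeMk S L x) = M.baseChangeMk S K (M.push g h x) :=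
  rfl

theorem heckeCorr_baseChangeMk (K' : Υ.Level) (σ : G) (K : Υ.Level) (x : M.obj K) :
    (M.baseChange S).heckeCorr K' σ K (M.baseChangeMk S K x) =
      M.baseChangeMk S K' (M.heckeCorr K' σ K x) :=
  rfl

theorem baseChangeMk_smul (V : Υ.Level) (r : R) (x : M.obj V) :
    M.baseChangeMk S V (r • x) = algebraMap R S r • M.baseChangeMk S V x := by
  change (1 : S) ⊗ₜ[R] (r • x) = algebraMap R S r • ((1 : S) ⊗ₜ[R] x)
  rw [TensorProduct.tmul_smul, algebraMap_smul]

theorem IsCohomological.baseChange (hM : M.IsCohomological) :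
    (M.baseChange S).IsCohomological := by
  intro L K h x
  refine TensorProduct.induction_on (motive := fun x : S ⊗[R] M.obj K =>
    (M.baseChange S).ind h ((M.baseChange S).res h x) = L.1.relIndex K.1 • x) x ?_ ?_ ?_
  · exact (congrArg _ (map_zero _)).trans ((map_zero _).trans (smul_zero _).symm)
  · intro s m
    rw [baseChange_res_tmul, baseChange_ind_tmul, hM, TensorProduct.tmul_smul]
  · intro a b ha hb
    exact (congrArg _ (map_add _ a b)).trans ((map_add _ _ _).trans
      ((congrArg₂ (· + ·) ha hb).trans (smul_add _ _ _).symm))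

theorem IsMackey.baseChange (hM : M.IsMackey) : (M.baseChange S).IsMackey := by
  intro K L L' hL hL' s h1 h2 x
  refine TensorProduct.induction_on (motive := fun x : S ⊗[R] M.obj L' =>
    (M.baseChange S).res hL ((M.baseChange S).ind hL' x) =
      ∑ γ ∈ s, (M.baseChange S).ind (infLevel_le_left L (conjLevel γ L'))
        ((M.baseChange S).pull γ (moves_mackey γ) x)) x ?_ ?_ ?_
  · refine (congrArg _ (map_zero _)).trans ((map_zero _).trans (Finset.sum_eq_zero ?_).symm)
    exact fun γ _ => (congrArg _ (map_zero _)).trans (map_zero _)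
  · intro a m
    rw [baseChange_ind_tmul, baseChange_res_tmul, hM K L L' hL hL' s h1 h2, TensorProduct.tmul_sum]
    rfl
  · intro a b ha hb
    refine (congrArg _ (map_add _ a b)).trans ((map_add _ _ _).trans
      ((congrArg₂ (· + ·) ha hb).trans (Finset.sum_add_distrib.symm.trans ?_)))
    refine Finset.sum_congr rfl fun γ _ => Eq.symm ?_
    exact (congrArg _ (map_add _ a b)).trans (map_add _ _ _)

theorem IsCoMack.baseChange (hM : M.IsCoMack) : (M.baseChange S).IsCoMack :=
  ⟨hM.1.baseChange S, hM.2.baseChange S⟩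

end BaseChange

end RICFunctor

/-! ### Functions on `G / K` and their coinvariants -/

section Cosets

variable {H : Type v} [Group H] {G : Type u} [Group G] {ι : H →* G}

theorem mem_comap_conjSub {K : Subgroup G} {g : G} {h : H} :
    h ∈ (conjSub g K).comap ι ↔ g⁻¹ * ι h * g ∈ K :=
  mem_conjSub

theorem mk_mul_eq_mk_mul_iff {K : Subgroup G} {g : G} {h h' : H} :
    ((ι h * g : G) : G ⧸ K) = (ι h' * g : G) ↔
      (h : H ⧸ (conjSub g K).comap ι) = h' := by
  rw [QuotientGroup.eq, QuotientGroup.eq, mem_comap_conjSub]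
  simp [mul_assoc]

theorem exists_eq_mul_of_mk_eq {K : Subgroup G} {g g' : G}
    (h : DoubleCoset.mk ι.range K g' = DoubleCoset.mk ι.range K g) :
    ∃ h : H, ∃ k ∈ K, g' = ι h * g * k := by
  obtain ⟨_, ⟨h, rfl⟩, k, hk, e⟩ := (DoubleCoset.eq _ _ _ _).1 h.symm
  exact ⟨h, k, hk, e⟩

end Cosets

section Functions

variable {H : Type v} [Group H] {G : Type u} [Group G] [TopologicalSpace G] [IsTopologicalGroup G]

theorem finite_image_mk_support {X : Type*} [Zero X] {K : Subgroup G} (hK : IsOpen (K : Set G))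
    {ξ : G → X} (hξ : HasCompactSupport ξ) :
    ((QuotientGroup.mk : G → G ⧸ K) '' Function.support ξ).Finite := by
  have : DiscreteTopology (G ⧸ K) := QuotientGroup.discreteTopology hK
  exact ((hξ.isCompact.image QuotientGroup.continuous_mk).finite_of_discrete).subset
    (Set.image_mono (subset_tsupport ξ))

/-- The function `y ⊗ ch(gK)` as an element of `C(G/K, τ)`, linearly in `y`. -/
noncomputable def cosetElem (Φ : Type t) [CommRing Φ] {K : Subgroup G} (hK : IsCompact (K : Set G))
    (τ : Type w) [AddCommGroup τ] [Module Φ τ] (g : G) : τ →ₗ[Φ] funSpace Φ K τ where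
  toFun y := ⟨cosetFun K y g, by
    refine ⟨HasCompactSupport.intro (hK.image (continuous_const_mul g)) fun x hx => ?_,
      fun x k hk => ?_⟩
    · refine if_neg fun h => hx ⟨g⁻¹ * x, h, by simp⟩
    · unfold cosetFun
      rw [← mul_assoc, K.mul_mem_cancel_right hk]⟩
  map_add' a b := by
    ext x
    change cosetFun K (a + b) g x = cosetFun K a g x + cosetFun K b g x
    unfold cosetFun
    split_ifs <;> simp
  map_smul' c a := by
    ext x
    change cosetFun K (c • a) g x = c • cosetFun K a g x
    unfold cosetFun
    split_ifs <;> simp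

variable {Φ : Type t} [CommRing Φ] {K : Subgroup G} (hK : IsCompact (K : Set G)) {τ : Type w}
  [AddCommGroup τ] [Module Φ τ]

theorem cosetElem_apply (g : G) (y : τ) : (cosetElem Φ hK τ g y).1 = cosetFun K y g :=
  rfl

theorem cosetElem_mul_right (g : G) {k : G} (hk : k ∈ K) :
    cosetElem Φ hK τ (g * k) = cosetElem Φ hK τ g := by
  ext y x
  change cosetFun K y (g * k) x = cosetFun K y g x
  unfold cosetFun
  rw [mul_inv_rev, mul_assoc, K.mul_mem_cancel_left (K.inv_mem hk)]

theorem funRep_cosetElem (ι : H →* G) (ρ : Representation Φ H τ) (h : H) (g : G) (y : τ) :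
    funRep ι K ρ h (cosetElem Φ hK τ g y) = cosetElem Φ hK τ (ι h * g) (ρ h y) := by
  ext x
  change ρ h (cosetFun K y g ((ι h)⁻¹ * x)) = cosetFun K (ρ h y) (ι h * g) x
  unfold cosetFun
  rw [mul_inv_rev, mul_assoc, apply_ite (ρ h), map_zero]

/-- Any element of `C(G/K, τ)` is the sum of its restrictions to the cosets in its support. -/
theorem exists_eq_sum_cosetElem (hKo : IsOpen (K : Set G)) (ξ : funSpace Φ K τ) :
    ∃ s : Finset (G ⧸ K), (∀ c ∈ s, ξ.1 c.out ≠ 0) ∧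
      ξ = ∑ c ∈ s, cosetElem Φ hK τ c.out (ξ.1 c.out) := by
  classical
  have hout : ∀ g : G, ξ.1 (g : G ⧸ K).out = ξ.1 g := apply_out_of_right_invariant ξ.1 ξ.2.2
  refine ⟨(finite_image_mk_support hKo ξ.2.1).toFinset, ?_, ?_⟩
  · intro c hc
    obtain ⟨g, hg, rfl⟩ := (Set.Finite.mem_toFinset _).1 hc
    rw [hout]
    exact hg
  · ext x
    rw [Submodule.coe_sum, Finset.sum_apply]
    have hval : ∀ c : G ⧸ K, (cosetElem Φ hK τ c.out (ξ.1 c.out)).1 x =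
        if c = (x : G ⧸ K) then ξ.1 x else 0 := by
      intro c
      change (if (Quotient.out c)⁻¹ * x ∈ K then ξ.1 c.out else 0) = _
      rw [← QuotientGroup.eq, QuotientGroup.out_eq']
      split_ifs with h
      · rw [h, hout]
      · rfl
    rw [Finset.sum_congr rfl fun c _ => hval c, Finset.sum_ite_eq']
    split_ifs with h
    · rfl
    · by_contra hx
      exact h ((Set.Finite.mem_toFinset _).2 ⟨x, hx, rfl⟩)

end Functions

section OrbitAverage

open RICFunctor

variable {H : Type v} [Group H] [TopologicalSpace H] [IsTopologicalGroup H] [LocallyCompactSpace H]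
  {G : Type u} [Group G] [TopologicalSpace G]
  {ΥH : LevelSystem H} {ΥG : LevelSystem G} {ι : H →* G}
  (hΥ : ∀ K ∈ ΥG.carrier, K.comap ι ∈ ΥH.carrier)
  {Φ : Type t} [Field Φ] [CharZero Φ] {N : RICFunctor.{v, w} Φ ΥH}

/-- The summand of the averaged sum over `H g K` attached to the coset `h (H ∩ gKg⁻¹)`. -/
noncomputable def orbitTerm (hN : N.IsCohomological) {K : ΥG.Level} (g : G)
    (ξ : G → N.Completion) (h : H) : N.obj (traceLevel ι hΥ g K) :=
  hN.average _ (N.act h⁻¹ (ξ (ι h * g)))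

theorem orbitTerm_mul_right (hN : N.IsCohomological) {K : ΥG.Level} (g : G)
    (ξ : funSpace Φ K.1 N.Completion) (h : H) :
    ∀ b ∈ (traceLevel ι hΥ g K).1,
      orbitTerm hΥ hN (K := K) g ξ.1 (h * b) = orbitTerm hΥ hN g ξ.1 h := by
  intro b hb
  have e : ι (h * b) * g = ι h * g * (g⁻¹ * ι b * g) := by simp [mul_assoc]
  have e2 : N.act (h * b)⁻¹ = N.act b⁻¹ * N.act h⁻¹ := by
    rw [mul_inv_rev]
    exact N.completionRep.map_mul _ _
  unfold orbitTerm
  rw [e, ξ.2.2 _ _ (mem_comap_conjSub.1 hb), e2, Module.End.mul_apply,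
    hN.average_act_of_mem (Subgroup.inv_mem _ hb)]

variable [IsTopologicalGroup G]

theorem finite_support_orbitTerm (hN : N.IsCohomological) {K : ΥG.Level} (g : G)
    (ξ : funSpace Φ K.1 N.Completion) :
    (Function.support fun c : H ⧸ (traceLevel ι hΥ g K).1 =>
      orbitTerm hΥ hN (K := K) g ξ.1 c.out).Finite := by
  refine ((finite_image_mk_support (ΥG.isOpen _ K.2) ξ.2.1).preimage
    (f := fun c : H ⧸ (traceLevel ι hΥ g K).1 => ((ι c.out * g : G) : G ⧸ K.1)) ?_).subset ?_
  · intro c _ d _ e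
    have := mk_mul_eq_mk_mul_iff.1 e
    rw [← QuotientGroup.out_eq' c, ← QuotientGroup.out_eq' d]
    exact this
  · intro c hc
    refine ⟨_, fun h0 => hc ?_, rfl⟩
    simp only [orbitTerm, h0, map_zero]

/-- The sum `∑_{h ∈ H / W} E_W(h⁻¹ ξ(h g))` for `W = H ∩ gKg⁻¹` and the averaging map
`E_W : M̂ → M(W)`: it factors through the coinvariants of `C(G/K, M̂)` and describes their part
supported on `H g K`. -/
noncomputable def orbitAverage (hN : N.IsCohomological) {K : ΥG.Level} (g : G) :
    funSpace Φ K.1 N.Completion →ₗ[Φ] N.obj (traceLevel ι hΥ g K) where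
  toFun ξ := ∑ᶠ c : H ⧸ (traceLevel ι hΥ g K).1, orbitTerm hΥ hN g ξ.1 c.out
  map_add' ξ η := by
    rw [← finsum_add_distrib (finite_support_orbitTerm hΥ hN g ξ)
      (finite_support_orbitTerm hΥ hN g η)]
    exact finsum_congr fun c => by simp [orbitTerm]
  map_smul' a ξ := by
    rw [RingHom.id_apply, smul_finsum]
    exact finsum_congr fun c => by simp [orbitTerm]

theorem orbitAverage_apply (hN : N.IsCohomological) {K : ΥG.Level} (g : G)
    (ξ : funSpace Φ K.1 N.Completion) :
    orbitAverage hΥ hN g ξ =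
      ∑ᶠ c : H ⧸ (traceLevel ι hΥ g K).1, orbitTerm hΥ hN g ξ.1 c.out :=
  rfl

theorem orbitAverage_funRep (hN : N.IsCohomological) {K : ΥG.Level} (g : G)
    (h : H) (ξ : funSpace Φ K.1 N.Completion) :
    orbitAverage hΥ hN g (funRep ι K.1 N.completionRep h ξ) = orbitAverage hΥ hN g ξ := by
  rw [orbitAverage_apply, orbitAverage_apply]
  refine Eq.trans ?_ (finsum_comp_equiv (MulAction.toPerm h⁻¹))
  refine finsum_congr fun c => ?_
  have e1 : MulAction.toPerm h⁻¹ c = ((h⁻¹ * c.out : H) : H ⧸ (traceLevel ι hΥ g K).1) := by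
    conv_lhs => rw [← QuotientGroup.out_eq' c]
    rfl
  have e2 : N.act (h⁻¹ * c.out)⁻¹ = N.act c.out⁻¹ * N.act h := by
    rw [mul_inv_rev, inv_inv]
    exact N.completionRep.map_mul _ _
  rw [e1, apply_out_of_right_invariant _ (orbitTerm_mul_right hΥ hN g ξ)]
  unfold orbitTerm
  rw [e2, map_mul, map_inv, mul_assoc]
  rfl

theorem orbitAverage_eq_of_mk_eq (hN : N.IsCohomological) {K : ΥG.Level} (g : G)
    {ξ η : funSpace Φ K.1 N.Completion}
    (h : Representation.Coinvariants.mk (funRep ι K.1 N.completionRep) ξ =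
      Representation.Coinvariants.mk (funRep ι K.1 N.completionRep) η) :
    orbitAverage hΥ hN g ξ = orbitAverage hΥ hN g η := by
  have := congrArg (Representation.Coinvariants.lift (funRep ι K.1 N.completionRep)
    (orbitAverage hΥ hN g) fun h => LinearMap.ext fun ξ => orbitAverage_funRep hΥ hN g h ξ) h
  simpa using this

theorem orbitAverage_cosetElem (hN : N.IsCohomological) {K : ΥG.Level} {g g' k : G} {h : H}
    (hk : k ∈ K.1) (e : g' = ι h * g * k) (y : N.Completion) :
    orbitAverage hΥ hN g (cosetElem Φ (ΥG.isCompact _ K.2) _ g' y) =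
      hN.average (traceLevel ι hΥ g K) (N.act h⁻¹ y) := by
  have hmem : ∀ x : G, g'⁻¹ * x ∈ K.1 ↔ (ι h * g)⁻¹ * x ∈ K.1 := by
    intro x
    rw [e, mul_inv_rev, mul_assoc, K.1.mul_mem_cancel_left (K.1.inv_mem hk)]
  rw [orbitAverage_apply, finsum_eq_single _ (h : H ⧸ (traceLevel ι hΥ g K).1),
    apply_out_of_right_invariant _ (orbitTerm_mul_right hΥ hN g _)]
  · unfold orbitTerm
    rw [cosetElem_apply, cosetFun, if_pos]
    rw [hmem, inv_mul_cancel]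
    exact K.1.one_mem
  · intro c hc
    unfold orbitTerm
    rw [cosetElem_apply, cosetFun, if_neg, map_zero, map_zero]
    rw [hmem, ← QuotientGroup.eq, mk_mul_eq_mk_mul_iff]
    intro h'
    exact hc ((QuotientGroup.out_eq' c).symm.trans h'.symm)

theorem orbitAverage_cosetElem_eq_zero (hN : N.IsCohomological) {K : ΥG.Level} {g g' : G}
    (hne : DoubleCoset.mk ι.range K.1 g' ≠ DoubleCoset.mk ι.range K.1 g) (y : N.Completion) :
    orbitAverage hΥ hN g (cosetElem Φ (ΥG.isCompact _ K.2) _ g' y) = 0 := by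
  rw [orbitAverage_apply]
  refine finsum_eq_zero_of_forall_eq_zero fun c => ?_
  unfold orbitTerm
  rw [cosetElem_apply, cosetFun, if_neg, map_zero, map_zero]
  intro hmem
  refine hne ((DoubleCoset.eq _ _ _ _).2 ⟨ι (Quotient.out c)⁻¹, ⟨_, rfl⟩, _, hmem, ?_⟩)
  simp [mul_assoc]

/-- Elements of `H ∩ gKg⁻¹` fix the coset `gK`, so in the coinvariants a value at `gK` may be
averaged over this group. -/
theorem mk_cosetElem_average (hN : N.IsCoMack) {K : ΥG.Level} (g : G) (y : N.Completion) :
    Representation.Coinvariants.mk (funRep ι K.1 N.completionRep)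
        (cosetElem Φ (ΥG.isCompact _ K.2) _ g
          (N.toCompletion _ (hN.1.average (traceLevel ι hΥ g K) y))) =
      Representation.Coinvariants.mk (funRep ι K.1 N.completionRep)
        (cosetElem Φ (ΥG.isCompact _ K.2) _ g y) := by
  obtain ⟨s, hs, hsW, e⟩ := hN.exists_toCompletion_average (traceLevel ι hΥ g K) y
  have hγ : ∀ γ ∈ s, Representation.Coinvariants.mk (funRep ι K.1 N.completionRep)
        (cosetElem Φ (ΥG.isCompact _ K.2) _ g (N.act γ y)) =
      Representation.Coinvariants.mk (funRep ι K.1 N.completionRep)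
        (cosetElem Φ (ΥG.isCompact _ K.2) _ g y) := by
    intro γ hγ
    rw [← Representation.Coinvariants.mk_self_apply _ γ (cosetElem Φ (ΥG.isCompact _ K.2) _ g y),
      funRep_cosetElem]
    have e : ι γ * g = g * (g⁻¹ * ι γ * g) := by simp [mul_assoc]
    rw [e, cosetElem_mul_right _ _ (mem_comap_conjSub.1 (hsW γ hγ))]
    rfl
  rw [e, map_smul, map_sum, map_smul, map_sum, Finset.sum_congr rfl hγ, Finset.sum_const,
    ← Nat.cast_smul_eq_nsmul Φ, smul_smul, inv_mul_cancel₀, one_smul]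
  exact Nat.cast_ne_zero.2 (Finset.card_pos.2 hs).ne'

theorem mk_cosetElem_eq_mk_orbitAverage (hN : N.IsCoMack) {K : ΥG.Level} {g g' : G}
    (h : DoubleCoset.mk ι.range K.1 g' = DoubleCoset.mk ι.range K.1 g) (y : N.Completion) :
    Representation.Coinvariants.mk (funRep ι K.1 N.completionRep)
        (cosetElem Φ (ΥG.isCompact _ K.2) _ g' y) =
      Representation.Coinvariants.mk (funRep ι K.1 N.completionRep)
        (cosetElem Φ (ΥG.isCompact _ K.2) _ g (N.toCompletion _
          (orbitAverage hΥ hN.1 g (cosetElem Φ (ΥG.isCompact _ K.2) _ g' y)))) := by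
  obtain ⟨h, k, hk, e⟩ := exists_eq_mul_of_mk_eq h
  rw [orbitAverage_cosetElem hΥ hN.1 hk e, mk_cosetElem_average hΥ hN,
    ← Representation.Coinvariants.mk_self_apply _ h⁻¹ (cosetElem Φ (ΥG.isCompact _ K.2) _ g' y),
      funRep_cosetElem]
  have e' : ι h⁻¹ * g' = g * k := by simp [e, mul_assoc]
  rw [e', cosetElem_mul_right _ _ hk]
  rfl

/-- The class of `ξ` in the coinvariants is determined by its averaged sums over representatives
of the double cosets `H \ G / K` that meet its support. -/
theorem mk_eq_sum_mk_orbitAverage (hN : N.IsCoMack) {K : ΥG.Level} {A : Type*} [Fintype A]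
    (rep : A → G) (hinj : Function.Injective fun α => DoubleCoset.mk ι.range K.1 (rep α))
    (ξ : funSpace Φ K.1 N.Completion)
    (hξ : ∀ g, ξ.1 g ≠ 0 → ∃ α, DoubleCoset.mk ι.range K.1 (rep α) = DoubleCoset.mk ι.range K.1 g) :
    Representation.Coinvariants.mk (funRep ι K.1 N.completionRep) ξ =
      ∑ α, Representation.Coinvariants.mk (funRep ι K.1 N.completionRep)
        (cosetElem Φ (ΥG.isCompact _ K.2) _ (rep α)
          (N.toCompletion _ (orbitAverage hΥ hN.1 (rep α) ξ))) := by
  obtain ⟨s, hs, e⟩ := exists_eq_sum_cosetElem (ΥG.isCompact _ K.2) (ΥG.isOpen _ K.2) ξ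
  have key : ∀ c ∈ s, Representation.Coinvariants.mk (funRep ι K.1 N.completionRep)
        (cosetElem Φ (ΥG.isCompact _ K.2) _ c.out (ξ.1 c.out)) =
      ∑ α, Representation.Coinvariants.mk (funRep ι K.1 N.completionRep)
        (cosetElem Φ (ΥG.isCompact _ K.2) _ (rep α)
          (N.toCompletion _ (orbitAverage hΥ hN.1 (rep α)
            (cosetElem Φ (ΥG.isCompact _ K.2) _ c.out (ξ.1 c.out))))) := by
    intro c hc
    obtain ⟨α, hα⟩ := hξ _ (hs c hc)
    rw [mk_cosetElem_eq_mk_orbitAverage hΥ hN hα.symm, Finset.sum_eq_single α]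
    · intro β _ hβ
      rw [orbitAverage_cosetElem_eq_zero]
      · simp only [map_zero]
      · rw [← hα]
        exact fun h => hβ (hinj h.symm)
    · exact fun h => absurd (Finset.mem_univ α) h
  conv_lhs => rw [e, map_sum, Finset.sum_congr rfl key, Finset.sum_comm]
  refine Finset.sum_congr rfl fun α _ => ?_
  conv_rhs => rw [e]
  simp only [map_sum]

end OrbitAverage

/-! ### Hecke operators and averaged sums -/

section HeckeSpace

open RICFunctor

variable {H : Type v} [Group H] [TopologicalSpace H] {G : Type u} [Group G] [TopologicalSpace G]
  {ΥH : LevelSystem H} {ΥG : LevelSystem G} {ι : H →* G}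
  (hΥ : ∀ K ∈ ΥG.carrier, K.comap ι ∈ ΥH.carrier)
  {O : Type z} [CommRing O] {U : ΥH.Level} {K : ΥG.Level}

theorem heckeSpace_mul_left (hU : U.1 = K.1.comap ι) (ξ : heckeSpace O K.1) {a : H} (ha : a ∈ U.1)
    (x : G) : ξ.1 (ι a * x) = ξ.1 x := by
  rw [hU] at ha
  simpa using ξ.2.2 _ ha 1 K.1.one_mem x

/-- For `g' = h g k` and `L` normal in `K`, the element `h` defines a morphism from any level below
`H ∩ g'Lg'⁻¹` to `H ∩ gLg⁻¹`. -/
theorem moves_traceLevel {L : ΥG.Level} (hLK : L ≤ K) (hnormal : (L.1.subgroupOf K.1).Normal)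
    {g g' k : G} {h : H} (hk : k ∈ K.1) (e : g' = ι h * g * k) {V : Subgroup H}
    (hV : V ≤ (conjSub g' L.1).comap ι) : Moves h V (traceLevel ι hΥ g L).1 := by
  intro x hx
  have h1 := mem_comap_conjSub.1 (hV hx)
  have h2 := hnormal.conj_mem ⟨_, hLK h1⟩ h1 ⟨k, hk⟩
  rw [Subgroup.mem_subgroupOf] at h2
  refine mem_comap_conjSub.2 ?_
  simpa [e, mul_assoc] using h2

variable [IsTopologicalGroup G]

theorem finite_setOf_quotient_inv_ne_zero (hU : U.1 = K.1.comap ι) (ξ : heckeSpace O K.1) (g : G) :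
    {c : H ⧸ U.1 | ξ.1 (ι c.out⁻¹ * g) ≠ 0}.Finite := by
  have hcs : HasCompactSupport fun x => ξ.1 x⁻¹ := ξ.2.1.comp_homeomorph (Homeomorph.inv G)
  refine ((finite_image_mk_support (ΥG.isOpen _ K.2) hcs).preimage
    (f := fun c : H ⧸ U.1 => ((g⁻¹ * ι c.out : G) : G ⧸ K.1)) ?_).subset ?_
  · intro c _ d _ e
    have e' := QuotientGroup.eq.1 e
    rw [← QuotientGroup.out_eq' c, ← QuotientGroup.out_eq' d, QuotientGroup.eq]
    refine hU.ge ?_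
    rw [Subgroup.mem_comap]
    simpa [mul_assoc] using e'
  · intro c hc
    refine ⟨_, ?_, rfl⟩
    simpa using hc

theorem finite_setOf_doubleCoset_ne_zero (ξ : heckeSpace O K.1) (g : G) :
    {D : DoubleCoset.Quotient (U.1 : Set H) ((traceLevel ι hΥ g K).1 : Set H) |
      ξ.1 (ι (Quotient.out D) * g) ≠ 0}.Finite := by
  refine ((finite_image_mk_support (ΥG.isOpen _ K.2) ξ.2.1).preimage
    (f := fun D : DoubleCoset.Quotient (U.1 : Set H) ((traceLevel ι hΥ g K).1 : Set H) =>
      ((ι (Quotient.out D) * g : G) : G ⧸ K.1)) ?_).subset ?_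
  · intro D _ D' _ e
    have e' := QuotientGroup.eq.1 (mk_mul_eq_mk_mul_iff.1 e)
    rw [← DoubleCoset.out_eq' _ _ D, ← DoubleCoset.out_eq' _ _ D', DoubleCoset.eq]
    exact ⟨1, U.1.one_mem, _, e', by simp⟩
  · exact fun D hD => ⟨_, hD, rfl⟩

variable {Φ : Type t} [Field Φ] [Algebra O Φ]

theorem finite_support_heckeAct (N : RICFunctor.{v, w} Φ ΥH) (hU : U.1 = K.1.comap ι) (g : G)
    (ξ : heckeSpace O K.1) (x : N.Completion) :
    (Function.support fun c : H ⧸ U.1 =>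
      algebraMap O Φ (transposeFun (twistedRes ι ξ.1 g) c.out) •
        N.completionRep c.out x).Finite := by
  refine (finite_setOf_quotient_inv_ne_zero hU ξ g).subset fun c hc h0 => hc ?_
  change algebraMap O Φ (ξ.1 (ι c.out⁻¹ * g)) • _ = _
  rw [h0, map_zero, zero_smul]

/-- The Hecke action turns `U`-invariant vectors into vectors invariant under `H ∩ gKg⁻¹`. -/
theorem act_heckeAct (N : RICFunctor.{v, w} Φ ΥH) (hU : U.1 = K.1.comap ι) (g : G)
    (ξ : heckeSpace O K.1) {x : N.Completion} (hx : ∀ a ∈ U.1, N.act a x = x) :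
    ∀ b ∈ (traceLevel ι hΥ g K).1,
      N.act b (heckeAct N.completionRep U.1 (transposeFun (twistedRes ι ξ.1 g)) x) =
        heckeAct N.completionRep U.1 (transposeFun (twistedRes ι ξ.1 g)) x := by
  intro b hb
  let φ : H → N.Completion := fun h => algebraMap O Φ (ξ.1 (ι h⁻¹ * g)) • N.act h x
  have hφ : ∀ h, ∀ a ∈ U.1, φ (h * a) = φ h := by
    intro h a ha
    change algebraMap O Φ (ξ.1 (ι (h * a)⁻¹ * g)) • N.act (h * a) x = _
    rw [mul_inv_rev, map_mul, mul_assoc, heckeSpace_mul_left hU ξ (U.1.inv_mem ha), act_mul_apply,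
      hx a ha]
  have hφ' : ∀ h, N.act b (φ h) = φ (b * h) := by
    intro h
    change N.act b (algebraMap O Φ (ξ.1 (ι h⁻¹ * g)) • N.act h x) =
      algebraMap O Φ (ξ.1 (ι (b * h)⁻¹ * g)) • N.act (b * h) x
    have e : ι (b * h)⁻¹ * g = 1 * (ι h⁻¹ * g) * (g⁻¹ * ι b⁻¹ * g) := by simp [mul_assoc]
    rw [map_smul, act_mul_apply, e, ξ.2.2 1 K.1.one_mem _
      (mem_comap_conjSub.1 (Subgroup.inv_mem _ hb))]
  refine (map_finsum (N.act b) (finite_support_heckeAct N hU g ξ x)).trans ?_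
  refine Eq.trans ?_ (finsum_comp_equiv (MulAction.toPerm b))
  refine finsum_congr fun c => ?_
  have e1 : MulAction.toPerm b c = ((b * c.out : H) : H ⧸ U.1) := by
    conv_lhs => rw [← QuotientGroup.out_eq' c]
    rfl
  rw [e1]
  exact (hφ' _).trans (apply_out_of_right_invariant φ hφ _).symm

end HeckeSpace

section HeckeSums

open RICFunctor

variable {H : Type v} [Group H] [TopologicalSpace H] [IsTopologicalGroup H] [LocallyCompactSpace H]
  {G : Type u} [Group G] [TopologicalSpace G]
  {ΥH : LevelSystem H} {ΥG : LevelSystem G} {ι : H →* G}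
  (hΥ : ∀ K ∈ ΥG.carrier, K.comap ι ∈ ΥH.carrier)
  {O : Type z} [CommRing O] {Φ : Type t} [Field Φ] [CharZero Φ] [Algebra O Φ]
  {N : RICFunctor.{v, w} Φ ΥH} {U : ΥH.Level} {K : ΥG.Level}

theorem RICFunctor.IsCohomological.relIndex_smul_average_act (hN : N.IsCohomological)
    (W : ΥH.Level) (σ : H) (m : N.obj U) :
    (conjSub σ U.1).relIndex W.1 • hN.average W (N.act σ (N.toCompletion U m)) =
      N.heckeCorr W σ U m := by
  rw [act_toCompletion, actLevel, LinearMap.comp_apply,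
    hN.average_toCompletion (infLevel_le_left (conjLevel σ U) W) (infLevel_le_right _ _),
    ← Nat.cast_smul_eq_nsmul Φ, smul_smul,
    show (infLevel (conjLevel σ U) W).1.relIndex W.1 = (conjSub σ U.1).relIndex W.1 from
      Subgroup.inf_relIndex_right _ _, mul_inv_cancel₀, one_smul]
  · unfold heckeCorr
    rw [LinearMap.comp_apply, LinearMap.comp_apply]
    congr 1
    have hmv : Moves σ (infLevel (conjLevel σ U) W).1 U.1 := fun x hx => mem_conjSub.1 hx.1
    exact (N.pull_mul_apply _ _ hmv (one_mul σ).symm m).trans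
      (N.pull_mul_apply _ _ hmv (mul_one σ).symm m).symm
  · exact relIndex_cast_ne_zero Φ (conjLevel σ U) W

theorem orbitTerm_tensorFun (hN : N.IsCohomological) (g : G) (ξ : heckeSpace O K.1)
    (x : N.Completion) (h : H) :
    orbitTerm hΥ hN (K := K) g (tensorFun (Φ := Φ) x ξ).1 h =
      algebraMap O Φ (ξ.1 (ι h * g)) • hN.average _ (N.act h⁻¹ x) := by
  unfold orbitTerm
  rw [← map_smul, ← map_smul]
  rfl

theorem orbitTerm_tensorFun_mul_left (hN : N.IsCohomological) (hU : U.1 = K.1.comap ι) (g : G)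
    (ξ : heckeSpace O K.1) {x : N.Completion} (hx : ∀ a ∈ U.1, N.act a x = x) :
    ∀ a ∈ U.1, ∀ h, orbitTerm hΥ hN (K := K) g (tensorFun (Φ := Φ) x ξ).1 (a * h) =
      orbitTerm hΥ hN g (tensorFun (Φ := Φ) x ξ).1 h := by
  intro a ha h
  rw [orbitTerm_tensorFun, orbitTerm_tensorFun, map_mul, mul_assoc, heckeSpace_mul_left hU ξ ha,
    mul_inv_rev, act_mul_apply, hx _ (U.1.inv_mem ha)]

variable [IsTopologicalGroup G]

theorem average_heckeAct (hN : N.IsCohomological) (hU : U.1 = K.1.comap ι) (g : G)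
    (ξ : heckeSpace O K.1) {x : N.Completion} (hx : ∀ a ∈ U.1, N.act a x = x) :
    hN.average (traceLevel ι hΥ g K)
        (heckeAct N.completionRep U.1 (transposeFun (twistedRes ι ξ.1 g)) x) =
      ∑ᶠ D : DoubleCoset.Quotient (U.1 : Set H) ((traceLevel ι hΥ g K).1 : Set H),
        (conjSub (Quotient.out D : H)⁻¹ U.1).relIndex (traceLevel ι hΥ g K).1 •
          orbitTerm hΥ hN g (tensorFun (Φ := Φ) x ξ).1 (Quotient.out D) := by
  have e : ∀ c : H ⧸ U.1, hN.average (traceLevel ι hΥ g K)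
      (algebraMap O Φ (transposeFun (twistedRes ι ξ.1 g) c.out) • N.completionRep c.out x) =
        orbitTerm hΥ hN g (tensorFun (Φ := Φ) x ξ).1 c.out⁻¹ := by
    intro c
    rw [orbitTerm_tensorFun, inv_inv, map_smul]
    rfl
  rw [← finsum_quotient_inv_eq_finsum_doubleCoset (orbitTerm hΥ hN g (tensorFun (Φ := Φ) x ξ).1)
    (fun d => relIndex_ne_zero (conjLevel d U) _) (orbitTerm_tensorFun_mul_left hΥ hN hU g ξ hx)
    (orbitTerm_mul_right hΥ hN g _)]
  · exact (map_finsum (hN.average _) (finite_support_heckeAct N hU g ξ x)).trans (finsum_congr e)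
  · refine (finite_setOf_quotient_inv_ne_zero hU ξ g).subset fun c hc h0 => hc ?_
    simp only [orbitTerm_tensorFun, h0, map_zero, zero_smul]

/-- Both sides are sums over `U \ H / W`, `W = H ∩ gKg⁻¹`, with multiplicities `[U : U ∩ dWd⁻¹]`
and `[W : W ∩ d⁻¹Ud]`; by unimodularity their ratio is `[U : W]`. -/
theorem orbitAverage_tensorFun (hH : IsUnimodular H) (hN : N.IsCohomological)
    (hU : U.1 = K.1.comap ι) (g : G) (ξ : heckeSpace O K.1) {x : N.Completion}
    (hx : ∀ a ∈ U.1, N.act a x = x) :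
    orbitAverage hΥ hN g (tensorFun (Φ := Φ) x ξ) =
      (genIndex U.1 (traceLevel ι hΥ g K).1 : Φ) • hN.average (traceLevel ι hΥ g K)
        (heckeAct N.completionRep U.1 (transposeFun (twistedRes ι ξ.1 g)) x) := by
  rw [average_heckeAct hΥ hN hU g ξ hx, smul_finsum, orbitAverage_apply,
    finsum_quotient_eq_finsum_doubleCoset (A := U.1) (orbitTerm hΥ hN g (tensorFun (Φ := Φ) x ξ).1)
      (fun d => relIndex_ne_zero (conjLevel d (traceLevel ι hΥ g K)) U)
      (orbitTerm_tensorFun_mul_left hΥ hN hU g ξ hx) (orbitTerm_mul_right hΥ hN g _)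
      (finite_support_orbitTerm hΥ hN g _)]
  refine finsum_congr fun D => ?_
  have := congrArg (Rat.cast : ℚ → Φ)
    (hH.relIndex_conjSub_swap U (traceLevel ι hΥ g K) (Quotient.out D))
  push_cast at this
  rw [← Nat.cast_smul_eq_nsmul Φ, ← Nat.cast_smul_eq_nsmul Φ, smul_smul, this]

theorem genIndex_cast_ne_zero (Φ : Type t) [Field Φ] [CharZero Φ] (V W : ΥH.Level) :
    (genIndex V.1 W.1 : Φ) ≠ 0 := by
  unfold genIndex
  push_cast
  exact div_ne_zero (relIndex_cast_ne_zero Φ W V) (relIndex_cast_ne_zero Φ V W)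

variable {MH : RICFunctor.{v, w} O ΥH}

/-- The Hecke action on the completion is given by the covariant Hecke correspondence. -/
theorem heckeAct_toCompletionBC (hMH : MH.IsCoMack) (hU : U.1 = K.1.comap ι) (xU : MH.obj U)
    (ξ : heckeSpace O K.1) (g : G) :
    heckeAct (MH.baseChange Φ).completionRep U.1 (transposeFun (twistedRes ι ξ.1 g))
        (MH.toCompletionBC Φ U xU) =
      MH.toCompletionBC Φ (traceLevel ι hΥ g K)
        (MH.heckeCov U (traceLevel ι hΥ g K) (twistedRes ι ξ.1 g) xU) := by
  have hN : (MH.baseChange Φ).IsCoMack := hMH.baseChange Φ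
  have hx : ∀ a ∈ U.1, (MH.baseChange Φ).act a (MH.toCompletionBC Φ U xU) =
      MH.toCompletionBC Φ U xU := fun a ha => act_toCompletion_of_mem _ ha _
  rw [← hN.toCompletion_average_of_invariant (traceLevel ι hΥ g K)
    (act_heckeAct hΥ (MH.baseChange Φ) hU g ξ hx), average_heckeAct hΥ hN.1 hU g ξ hx]
  rw [toCompletionBC_eq]
  congr 1
  refine Eq.trans (finsum_congr fun D => ?_)
    (map_finsum (MH.baseChangeMk Φ (traceLevel ι hΥ g K)) ?_).symm
  · rw [orbitTerm_tensorFun, smul_comm, hN.1.relIndex_smul_average_act,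
      heckeCorr_baseChangeMk, baseChangeMk_smul]
    rfl
  · refine (finite_setOf_doubleCoset_ne_zero hΥ ξ g).subset fun D hD h0 => hD ?_
    change ξ.1 (ι (Quotient.out D) * g) • _ = _
    rw [h0, zero_smul]

/-- The criterion at `g` as an equation for the averaged sum of `j_U(x_U) ⊗ ξ`. -/
theorem heckeAct_eq_toCompletionBC_iff (hH : IsUnimodular H) (hMH : MH.IsCoMack)
    (hU : U.1 = K.1.comap ι) (xU : MH.obj U) (ξ : heckeSpace O K.1) (g : G)
    (y : MH.obj (traceLevel ι hΥ g K)) :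
    heckeAct (MH.baseChange Φ).completionRep U.1 (transposeFun (twistedRes ι ξ.1 g))
        (MH.toCompletionBC Φ U xU) = MH.toCompletionBC Φ (traceLevel ι hΥ g K) y ↔
      orbitAverage hΥ (hMH.1.baseChange Φ) g (tensorFun (Φ := Φ) (MH.toCompletionBC Φ U xU) ξ) =
        (genIndex U.1 (traceLevel ι hΥ g K).1 : Φ) •
          MH.baseChangeMk Φ (traceLevel ι hΥ g K) y := by
  have hN : (MH.baseChange Φ).IsCoMack := hMH.baseChange Φ
  have hx : ∀ a ∈ U.1, (MH.baseChange Φ).act a (MH.toCompletionBC Φ U xU) =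
      MH.toCompletionBC Φ U xU := fun a ha => act_toCompletion_of_mem _ ha _
  rw [orbitAverage_tensorFun hΥ hH (hMH.1.baseChange Φ) hU g ξ hx,
    heckeAct_toCompletionBC hΥ hMH hU]
  rw [toCompletionBC_eq, toCompletionBC_eq, (hMH.1.baseChange Φ).average_toCompletion_self,
    (hN.1.toCompletion_injective _).eq_iff]
  exact (smul_right_injective _ (genIndex_cast_ne_zero Φ _ _)).eq_iff.symm

/-- The volume factor of an integral term becomes independent of its level after averaging. -/
theorem genIndex_smul_average (hH : IsUnimodular H) (hMH : MH.IsCohomological) (U : ΥH.Level)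
    {V V' W : ΥH.Level} {h : H} (hm : Moves h V.1 V'.1) (hVW : V' ≤ W) (x : MH.obj V) :
    (genIndex U.1 V.1 : Φ) • (hMH.baseChange Φ).average W
        ((MH.baseChange Φ).act h⁻¹ (MH.toCompletionBC Φ V x)) =
      (genIndex U.1 W.1 : Φ) •
        MH.baseChangeMk Φ W (MH.ind hVW (MH.push h hm x)) := by
  have hm' : Moves h V.1 W.1 := fun y hy => hVW (hm y hy)
  have e := congrArg (Rat.cast : ℚ → Φ) (hH.genIndex_mul_inv_relIndex U V W hm')
  push_cast at e
  rw [toCompletionBC_eq, (hMH.baseChange Φ).average_act_toCompletion hm', smul_smul, e,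
    push_baseChangeMk, ind,
    MH.push_mul_apply _ hm hm' (mul_one h).symm]

end HeckeSums

/-! ### Pushforwards of integral presentations -/

section Pushforward

open RICFunctor

variable {R : Type z} [CommRing R] {H : Type v} [Group H] [TopologicalSpace H] {G : Type u}
  [Group G] [TopologicalSpace G] {ΥH : LevelSystem H} {ΥG : LevelSystem G} {ι : H →* G}
  (hΥ : ∀ K ∈ ΥG.carrier, K.comap ι ∈ ΥH.carrier)
  {MH : RICFunctor.{v, w} R ΥH} {MG : RICFunctor.{u, w'} R ΥG} (p : Pushforward ι MH MG)

theorem Pushforward.map_ind {V W : ΥH.Level} {K : ΥG.Level} (h : V ≤ W) (hW : W.1 ≤ K.1.comap ι)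
    (x : MH.obj V) : p.map W K hW (MH.ind h x) = p.map V K (le_trans (α := Subgroup H) h hW) x := by
  have h1 : Moves (ι 1) K.1 K.1 := by
    rw [map_one]
    exact Moves.of_le le_rfl
  have := LinearMap.congr_fun (p.comm V W K K (le_trans (α := Subgroup H) h hW) hW 1 (Moves.of_le h) h1) x
  rwa [MG.push_of_mem K _ (by rw [map_one]; exact K.1.one_mem)] at this

/-- The mixed Hecke correspondence of `V ⊆ H ∩ σKσ⁻¹` involves no restriction. -/
theorem mixedHecke_of_le {V : ΥH.Level} {σ : G} {K : ΥG.Level}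
    (h : V.1 ≤ (conjLevel σ K).1.comap ι) (x : MH.obj V) :
    mixedHecke hΥ p V σ K x = MG.push σ (moves_conjLevel σ K) (p.map V (conjLevel σ K) h x) := by
  have hle : V ≤ infLevel V (traceLevel ι hΥ σ K) := fun y hy => ⟨hy, h hy⟩
  conv_rhs => rw [← MH.ind_res_of_antisymm (infLevel_le_left V (traceLevel ι hΥ σ K)) hle x,
    p.map_ind]
  rfl

/-- A term of level `V ⊆ H ∩ g'Lg'⁻¹` and its translate at `g`, where `g' = h g k`, have the same
pushforward to `K`. -/
theorem ind_mixedHecke {L K : ΥG.Level} (hLK : L ≤ K) {g g' k : G} {h : H}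
    (hk : k ∈ K.1) (e : g' = ι h * g * k) {V : ΥH.Level} (hV : V.1 ≤ (conjSub g' L.1).comap ι)
    (hm : Moves h V.1 (traceLevel ι hΥ g L).1) (x : MH.obj V) :
    MG.ind hLK (mixedHecke hΥ p V g' L x) =
      mixedHecke hΥ p (traceLevel ι hΥ g L) g K (MH.push h hm x) := by
  have hkK : Moves k K.1 K.1 := fun y hy => K.1.mul_mem (K.1.mul_mem (K.1.inv_mem hk) hy) hk
  have h1 : Moves (ι h * g) (conjLevel g' L).1 K.1 := by
    intro y hy
    have h2 := K.1.mul_mem (K.1.mul_mem hk (hLK (mem_conjSub.1 hy))) (K.1.inv_mem hk)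
    simpa [e, mul_assoc] using h2
  have h2 : Moves (ι h) (conjLevel g' L).1 (conjLevel g K).1 := fun y hy =>
    mem_conjSub.2 (by simpa [mul_assoc] using h1 y hy)
  have h3 : Moves g' (conjLevel g' L).1 K.1 := fun y hy => hLK (mem_conjSub.1 hy)
  have hc := LinearMap.congr_fun (p.comm V (traceLevel ι hΥ g L) (conjLevel g' L) (conjLevel g K) hV
    (traceLevel_mono ι hΥ g hLK) h hm h2) x
  rw [LinearMap.comp_apply, LinearMap.comp_apply] at hc
  rw [mixedHecke_of_le hΥ p hV, mixedHecke_of_le hΥ p (traceLevel_mono ι hΥ g hLK), hc, ind,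
    MG.push_mul_apply _ _ h3 (mul_one g').symm, MG.push_mul_apply _ _ h1 rfl,
    ← MG.push_mul_apply hkK h1 h3 e, MG.push_of_mem K k hk]
  rfl

theorem mixedHecke_eq_zero_of_ind_eq_zero {L K : ΥG.Level} (hLK : L ≤ K) {g : G}
    {x : MH.obj (traceLevel ι hΥ g L)} (hx : MH.ind (traceLevel_mono ι hΥ g hLK) x = 0) :
    mixedHecke hΥ p (traceLevel ι hΥ g L) g K x = 0 := by
  rw [mixedHecke_of_le hΥ p (traceLevel_mono ι hΥ g hLK),
    ← p.map_ind (K := conjLevel g K) (traceLevel_mono ι hΥ g hLK) le_rfl, hx, map_zero,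
    map_zero]

end Pushforward

/-! ### Zeta elements and their associated classes -/

section Zeta

open RICFunctor

variable {H : Type v} [Group H] [TopologicalSpace H] [IsTopologicalGroup H] [LocallyCompactSpace H]
  {G : Type u} [Group G] [TopologicalSpace G] [IsTopologicalGroup G]
  {ΥH : LevelSystem H} {ΥG : LevelSystem G} {ι : H →* G}
  (hΥ : ∀ K ∈ ΥG.carrier, K.comap ι ∈ ΥH.carrier)
  {O : Type z} [CommRing O] {Φ : Type t} [Field Φ] [CharZero Φ] [Algebra O Φ]
  {MH : RICFunctor.{v, w} O ΥH} (U : ΥH.Level) {K L : ΥG.Level}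

/-- The averaged sums of an integral function are, up to the factor `[U : H ∩ gKg⁻¹]`, induced from
classes of level `H ∩ gLg⁻¹`. -/
theorem IsIntegralAt.exists_orbitAverage_eq (hH : IsUnimodular H) (hMH : MH.IsCohomological)
    (hLK : L ≤ K) (hnormal : (L.1.subgroupOf K.1).Normal)
    {ζ : funSpace Φ K.1 (MH.baseChange Φ).Completion} (hζ : IsIntegralAt ι MH U L ζ.1) (g : G) :
    ∃ x : MH.obj (traceLevel ι hΥ g L),
      orbitAverage hΥ (hMH.baseChange Φ) g ζ =
        (genIndex U.1 (traceLevel ι hΥ g K).1 : Φ) •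
          MH.baseChangeMk Φ (traceLevel ι hΥ g K) (MH.ind (traceLevel_mono ι hΥ g hLK) x) := by
  refine finsum_induction (fun m => ∃ x : MH.obj (traceLevel ι hΥ g L),
    m = (genIndex U.1 (traceLevel ι hΥ g K).1 : Φ) •
      MH.baseChangeMk Φ (traceLevel ι hΥ g K) (MH.ind (traceLevel_mono ι hΥ g hLK) x)) ?_ ?_ ?_
  · exact ⟨0, by simp only [map_zero, smul_zero]⟩
  · rintro _ _ ⟨a, rfl⟩ ⟨b, rfl⟩
    exact ⟨a + b, by simp only [map_add, smul_add]⟩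
  · intro c
    obtain ⟨n, V, hV, x, e⟩ := hζ (ι c.out * g)
    have hm : ∀ i, Moves c.out (V i).1 (traceLevel ι hΥ g L).1 := fun i =>
      moves_traceLevel hΥ hLK hnormal K.1.one_mem (mul_one _).symm (hV i)
    refine ⟨∑ i, MH.push c.out (hm i) (x i), ?_⟩
    unfold orbitTerm
    rw [e]
    simp only [map_sum, map_smul, Finset.smul_sum]
    exact Finset.sum_congr rfl fun i _ => genIndex_smul_average hH hMH U (hm i) _ (x i)

/-- For a presentation of `ζ` by integral terms, the terms supported on a double coset `H g K` are
moved to one class of level `H ∩ gLg⁻¹`. It computes both the averaged sum of `ζ` at `g` and the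
part of the pushforward that comes from these terms. -/
theorem exists_class_of_presentation (hH : IsUnimodular H) (hMH : MH.IsCohomological)
    {MG : RICFunctor.{u, w'} O ΥG} (p : Pushforward ι MH MG)
    (hLK : L ≤ K) (hnormal : (L.1.subgroupOf K.1).Normal)
    {ζ : funSpace Φ K.1 (MH.baseChange Φ).Completion} {n : ℕ} {g : Fin n → G} {V : Fin n → ΥH.Level}
    (hV : ∀ i, (V i).1 ≤ (conjSub (g i) L.1).comap ι) (x : ∀ i, MH.obj (V i))
    (hζ : ζ.1 = ∑ i, cosetFun K.1 ((genIndex U.1 (V i).1 : Φ) • MH.toCompletionBC Φ (V i) (x i))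
      (g i)) (g₀ : G) :
    ∃ y : MH.obj (traceLevel ι hΥ g₀ L),
      orbitAverage hΥ (hMH.baseChange Φ) g₀ ζ =
        (genIndex U.1 (traceLevel ι hΥ g₀ K).1 : Φ) •
          MH.baseChangeMk Φ (traceLevel ι hΥ g₀ K) (MH.ind (traceLevel_mono ι hΥ g₀ hLK) y) ∧
      mixedHecke hΥ p (traceLevel ι hΥ g₀ L) g₀ K y =
        ∑ᶠ (i) (_ : DoubleCoset.mk ι.range K.1 (g i) = DoubleCoset.mk ι.range K.1 g₀),
          MG.ind hLK (mixedHecke hΥ p (V i) (g i) L (x i)) := by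
  classical
  have hterm : ∀ i, ∃ y : MH.obj (traceLevel ι hΥ g₀ L),
      orbitAverage hΥ (hMH.baseChange Φ) g₀ (cosetElem Φ (ΥG.isCompact _ K.2) _ (g i)
        ((genIndex U.1 (V i).1 : Φ) • MH.toCompletionBC Φ (V i) (x i))) =
        (genIndex U.1 (traceLevel ι hΥ g₀ K).1 : Φ) •
          MH.baseChangeMk Φ (traceLevel ι hΥ g₀ K) (MH.ind (traceLevel_mono ι hΥ g₀ hLK) y) ∧
      mixedHecke hΥ p (traceLevel ι hΥ g₀ L) g₀ K y =
        ∑ᶠ _ : DoubleCoset.mk ι.range K.1 (g i) = DoubleCoset.mk ι.range K.1 g₀,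
          MG.ind hLK (mixedHecke hΥ p (V i) (g i) L (x i)) := by
    intro i
    by_cases hi : DoubleCoset.mk ι.range K.1 (g i) = DoubleCoset.mk ι.range K.1 g₀
    · obtain ⟨h, k, hk, e⟩ := exists_eq_mul_of_mk_eq hi
      have hm := moves_traceLevel hΥ hLK hnormal hk e (hV i)
      refine ⟨MH.push h hm (x i), ?_, ?_⟩
      · rw [orbitAverage_cosetElem hΥ (hMH.baseChange Φ) hk e, map_smul, map_smul,
          genIndex_smul_average hH hMH U hm (traceLevel_mono ι hΥ g₀ hLK)]
      · rw [finsum_eq_if, if_pos hi, ind_mixedHecke hΥ p hLK hk e (hV i) hm]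
    · refine ⟨0, ?_, ?_⟩
      · rw [orbitAverage_cosetElem_eq_zero hΥ _ hi]
        simp only [map_zero, smul_zero]
      · rw [finsum_eq_if, if_neg hi, map_zero]
  choose y hy1 hy2 using hterm
  have hsum : ζ = ∑ i, cosetElem Φ (ΥG.isCompact _ K.2) _ (g i)
      ((genIndex U.1 (V i).1 : Φ) • MH.toCompletionBC Φ (V i) (x i)) := by
    ext1
    rw [hζ, Submodule.coe_sum]
    rfl
  refine ⟨∑ i, y i, ?_, ?_⟩
  · rw [hsum]
    simp only [map_sum, Finset.smul_sum]
    exact Finset.sum_congr rfl fun i _ => hy1 i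
  · rw [map_sum, finsum_eq_sum_of_fintype]
    exact Finset.sum_congr rfl fun i _ => hy2 i

end Zeta

/-! ### The criterion for zeta elements -/

theorem theorem3p9
    {H : Type*} [Group H] [TopologicalSpace H] [IsTopologicalGroup H] [LocallyCompactSpace H]
    [T2Space H] [TotallyDisconnectedSpace H] (hH : IsUnimodular H)
    {G : Type*} [Group G] [TopologicalSpace G] [IsTopologicalGroup G] [LocallyCompactSpace G]
    [T2Space G] [TotallyDisconnectedSpace G] (hG : IsUnimodular G)
    (ι : H →* G) (hι : Topology.IsClosedEmbedding ι)
    (ΥH : LevelSystem H) (ΥG : LevelSystem G)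
    (hΥ : ∀ K ∈ ΥG.carrier, K.comap ι ∈ ΥH.carrier)
    {O : Type*} [CommRing O] [IsDomain O] [CharZero O]
    {Φ : Type*} [Field Φ] [Algebra O Φ] (hΦ : Function.Injective (algebraMap O Φ))
    (MH : RICFunctor O ΥH) (hMH : MH.IsCoMack)
    (MG : RICFunctor O ΥG) (hMG : MG.IsCoMack)
    (p : Pushforward ι MH MG)
    (U : ΥH.Level) (K : ΥG.Level) (hU : U.1 = K.1.comap ι)
    (xU : MH.obj U)
    (Hp : heckeSpace O K.1) (hHp : Hp ≠ 0)
    (L : ΥG.Level) (hLK : L ≤ K) (hnormal : (L.1.subgroupOf K.1).Normal)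
    -- a representative `rep α` of each double coset `α` in `H \ (H · supp ℌ) / K`
    (rep : SuppClasses ι Hp.1 K.1 → G)
    (hrep : ∀ α, DoubleCoset.mk ι.range K.1 (rep α) = α.1) :
    -- existence of a zeta element is equivalent to the criterion
    ((∃ ζ : funSpace Φ K.1 (MH.baseChange Φ).Completion, IsZetaElement ι MH U K L xU Hp ζ) ↔
      ∃ x : ∀ α, MH.obj (traceLevel ι hΥ (rep α) L), ∀ α,
        heckeAct (MH.baseChange Φ).completionRep U.1
            (transposeFun (twistedRes ι Hp.1 (rep α))) (MH.toCompletionBC Φ U xU) =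
          MH.toCompletionBC Φ (traceLevel ι hΥ (rep α) K)
            (MH.ind (traceLevel_mono ι hΥ (rep α) hLK) (x α))) ∧
    -- each equation of the criterion is a norm relation up to torsion
    (∀ (α : SuppClasses ι Hp.1 K.1) (x : MH.obj (traceLevel ι hΥ (rep α) L)),
      heckeAct (MH.baseChange Φ).completionRep U.1
            (transposeFun (twistedRes ι Hp.1 (rep α))) (MH.toCompletionBC Φ U xU) =
          MH.toCompletionBC Φ (traceLevel ι hΥ (rep α) K)
            (MH.ind (traceLevel_mono ι hΥ (rep α) hLK) x) ↔
        MH.heckeCov U (traceLevel ι hΥ (rep α) K) (twistedRes ι Hp.1 (rep α)) xU -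
            MH.ind (traceLevel_mono ι hΥ (rep α) hLK) x ∈
          Submodule.torsion O (MH.obj (traceLevel ι hΥ (rep α) K))) ∧
    -- in the torsion free case any associated class can be recovered
    (MH.IsTorsionFree →
      ∀ ζ : funSpace Φ K.1 (MH.baseChange Φ).Completion, IsZetaElement ι MH U K L xU Hp ζ →
      ∀ yL : MG.obj L, IsAssociatedClass hΥ p U K L ζ.1 yL →
      ∃ x : ∀ α, MH.obj (traceLevel ι hΥ (rep α) L),
        (∀ α, heckeAct (MH.baseChange Φ).completionRep U.1
            (transposeFun (twistedRes ι Hp.1 (rep α))) (MH.toCompletionBC Φ U xU) =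
          MH.toCompletionBC Φ (traceLevel ι hΥ (rep α) K)
            (MH.ind (traceLevel_mono ι hΥ (rep α) hLK) (x α))) ∧
        MG.ind hLK yL =
          ∑ᶠ α, mixedHecke hΥ p (traceLevel ι hΥ (rep α) L) (rep α) K (x α)) := by
  have hΦ0 : CharZero Φ := charZero_of_injective_algebraMap hΦ
  have hN : (MH.baseChange Φ).IsCoMack := hMH.baseChange Φ
  have hne : ∀ V W : ΥH.Level, (genIndex V.1 W.1 : Φ) ≠ 0 := genIndex_cast_ne_zero Φ
  have hiff := heckeAct_eq_toCompletionBC_iff (Φ := Φ) hΥ hH hMH hU xU Hp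
  refine ⟨⟨?_, ?_⟩, ?_, ?_⟩
  · rintro ⟨ζ, hint, hmk⟩
    choose x hx using fun α => hint.exists_orbitAverage_eq hΥ U hH hMH.1 hLK hnormal (rep α)
    refine ⟨x, fun α => (hiff _ _).2 ?_⟩
    rw [← hx, orbitAverage_eq_of_mk_eq hΥ hN.1 _ hmk]
  · rintro ⟨x, hx⟩
    have : Finite (SuppClasses ι Hp.1 K.1) := finite_suppClasses ι (ΥG.isOpen _ K.2) Hp.2.1
    have := Fintype.ofFinite (SuppClasses ι Hp.1 K.1)
    have hinj : Function.Injective fun α => DoubleCoset.mk ι.range K.1 (rep α) := by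
      intro α β h
      simp only [hrep] at h
      exact Subtype.ext h
    -- the zeta element is the sum of the `[U : V_α] j_{V_α}(x_α) ⊗ ch(g_α K)`
    let y : SuppClasses ι Hp.1 K.1 → (MH.baseChange Φ).Completion := fun α =>
      (genIndex U.1 (traceLevel ι hΥ (rep α) L).1 : Φ) •
        MH.toCompletionBC Φ (traceLevel ι hΥ (rep α) L) (x α)
    let ζ : funSpace Φ K.1 (MH.baseChange Φ).Completion :=
      ∑ α, cosetElem Φ (ΥG.isCompact _ K.2) _ (rep α) (y α)
    have hζval : ∀ g, ζ.1 g = ∑ α, cosetFun K.1 (y α) (rep α) g := by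
      intro g
      rw [Submodule.coe_sum, Finset.sum_apply]
      rfl
    have hζsupp : ∀ g, ζ.1 g ≠ 0 → ∃ α, (rep α)⁻¹ * g ∈ K.1 ∧ ζ.1 g = y α := by
      intro g hg
      rw [hζval] at hg ⊢
      obtain ⟨α, -, hα⟩ := Finset.exists_ne_zero_of_sum_ne_zero hg
      have hαK : (rep α)⁻¹ * g ∈ K.1 := by
        by_contra h
        exact hα (if_neg h)
      refine ⟨α, hαK, (Finset.sum_eq_single α (fun β _ hβ => if_neg fun hβK => hβ ?_)
        fun h => absurd (Finset.mem_univ α) h).trans (if_pos hαK)⟩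
      refine hinj ((DoubleCoset.eq _ _ _ _).2 ⟨1, ι.range.one_mem, _,
        K.1.mul_mem hβK (K.1.inv_mem hαK), ?_⟩)
      simp [mul_assoc]
    have hζavg : ∀ α, orbitAverage hΥ hN.1 (rep α) ζ =
        orbitAverage hΥ hN.1 (rep α) (tensorFun (Φ := Φ) (MH.toCompletionBC Φ U xU) Hp) := by
      intro α
      rw [(hiff _ _).1 (hx α), map_sum, Finset.sum_eq_single α]
      · have hm : Moves (1 : H) (traceLevel ι hΥ (rep α) L).1 (traceLevel ι hΥ (rep α) L).1 :=
          Moves.of_le le_rfl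
        rw [orbitAverage_cosetElem hΥ hN.1 (h := 1) K.1.one_mem (by simp), map_smul, map_smul,
          genIndex_smul_average hH hMH.1 U hm (traceLevel_mono ι hΥ (rep α) hLK), MH.push_one]
        rfl
      · intro β _ hβ
        exact orbitAverage_cosetElem_eq_zero hΥ hN.1 (fun h => hβ (hinj h)) _
      · exact fun h => absurd (Finset.mem_univ α) h
    refine ⟨ζ, fun g => ?_, ?_⟩
    · -- for `g ∈ g_α K` one has `g L g⁻¹ = g_α L g_α⁻¹`, as `L` is normal in `K`
      by_cases hg : ζ.1 g = 0
      · exact ⟨0, Fin.elim0, fun i => i.elim0, fun i => i.elim0, by simpa using hg⟩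
      · obtain ⟨α, hα, e⟩ := hζsupp g hg
        refine ⟨1, fun _ => traceLevel ι hΥ (rep α) L, fun _ h hh => ?_, fun _ => x α, ?_⟩
        · have h1 := mem_comap_conjSub.1 hh
          have h2 := hnormal.conj_mem ⟨_, hLK h1⟩ h1 ⟨_, K.1.inv_mem hα⟩
          rw [Subgroup.mem_subgroupOf] at h2
          refine mem_comap_conjSub.2 ?_
          simpa [mul_assoc] using h2
        · rw [e]
          simp [y]
    · rw [mk_eq_sum_mk_orbitAverage hΥ hN rep hinj ζ, mk_eq_sum_mk_orbitAverage hΥ hN rep hinj]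
      · exact Finset.sum_congr rfl fun α _ => by rw [hζavg α]
      · intro g hg
        have hg' : Hp.1 g ≠ 0 := fun h0 => hg (by
          change algebraMap O Φ (Hp.1 g) • _ = (0 : (MH.baseChange Φ).Completion)
          rw [h0, map_zero, zero_smul])
        exact ⟨⟨_, g, hg', rfl⟩, hrep _⟩
      · intro g hg
        obtain ⟨α, hα, -⟩ := hζsupp g hg
        exact ⟨α, (DoubleCoset.eq _ _ _ _).2 ⟨1, ι.range.one_mem, _, hα, by simp⟩⟩
  · intro α x
    rw [heckeAct_toCompletionBC hΥ hMH hU, RICFunctor.toCompletionBC_eq, RICFunctor.toCompletionBC_eq,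
      (hN.1.toCompletion_injective _).eq_iff, ← sub_eq_zero, ← map_sub]
    exact one_tmul_eq_zero_iff_mem_torsion hΦ _
  · rintro htf ζ ⟨-, hmk⟩ yL ⟨n, g, V, hV, x, hζ, rfl⟩
    have hpres := exists_class_of_presentation hΥ U hH hMH.1 p hLK hnormal hV x hζ
    choose y hy1 hy2 using fun α => hpres (rep α)
    refine ⟨y, fun α => (hiff _ _).2 ?_, ?_⟩
    · rw [← hy1, orbitAverage_eq_of_mk_eq hΥ hN.1 _ hmk]
    · rw [map_sum, sum_eq_finsum_subtype_fiber (fun i => DoubleCoset.mk ι.range K.1 (g i)) _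
        (fun β => ∃ g, Hp.1 g ≠ 0 ∧ DoubleCoset.mk ι.range K.1 g = β)]
      · refine finsum_congr fun α => ?_
        rw [hy2, hrep]
      · intro β hβ
        obtain ⟨g₀, rfl⟩ : ∃ g₀, DoubleCoset.mk ι.range K.1 g₀ = β :=
          ⟨Quotient.out β, DoubleCoset.out_eq' _ _ β⟩
        obtain ⟨z, hz1, hz2⟩ := hpres g₀
        rw [← hz2]
        refine mixedHecke_eq_zero_of_ind_eq_zero hΥ p hLK ?_
        -- the averaged sums of `ζ` and of `j_U(x_U) ⊗ ℌ` agree, and the latter vanishes at `g₀`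
        have h0 : orbitAverage hΥ hN.1 g₀
            (tensorFun (Φ := Φ) (MH.toCompletionBC Φ U xU) Hp) = 0 := by
          rw [orbitAverage_apply]
          refine finsum_eq_zero_of_forall_eq_zero fun c => ?_
          have hc : Hp.1 (ι c.out * g₀) = 0 := by
            by_contra hc
            refine hβ ⟨_, hc, (DoubleCoset.eq _ _ _ _).2
              ⟨ι (Quotient.out c)⁻¹, ⟨_, rfl⟩, 1, K.1.one_mem, ?_⟩⟩
            simp
          rw [orbitTerm_tensorFun, hc, map_zero, zero_smul]
        rw [orbitAverage_eq_of_mk_eq hΥ hN.1 _ hmk, h0, eq_comm,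
          smul_eq_zero_iff_right (hne _ _)] at hz1
        have htors := (one_tmul_eq_zero_iff_mem_torsion hΦ _).1 hz1
        have := htf (traceLevel ι hΥ g₀ K)
        rwa [Submodule.isTorsionFree_iff_torsion_eq_bot.1 this, Submodule.mem_bot] at htors
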